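/- **Setting.** Let $1\le r\le\infty$, let $U\subseteq\mathbb R^2$ be open, $f:U\to\mathbb R$ smooth with regular value $0$, $\Sigma=f^{-1}(0)$, and let $X_0=(X_1,X_2)$ be a non-smooth vector field, where $X_1,X_2$ are $C^r$ on $U$, $X_1$ acts on $\Sigma_+=\{f\ge0\}$ and $X_2$ on $\Sigma_-=\{f\le 0\}$. Write $X_i.f=\langle\nabla f,X_i\rangle$. The sliding region is $\{q\in\Sigma: X_1.f<0<X_2.f\}$, the escaping region is $\{q\in\Sigma: X_2.f<0<X_1.f\}$, and the sliding (escaping) field is $X_0^\Sigma=\frac{(X_2.f)X_1-(X_1.f)X_2}{X_2.f-X_1.f}$. A contact point is a $q\in\Sigma$ with $X_1.f(q)\,X_2.f(q)=0$ at which $X_0^\Sigma$ is defined (that is, $X_1.f(q)\ne X_2.f(q)$) and nonzero; it is a $\Sigma$-fold point if, for $i=1$ or $i=2$, $X_i.f(q)=0\neq X_i^2.f(q)$, and a visible fold of $X_1$ if $X_1.f(q)=0<X_1^2.f(q)$. Assume that $X_0$ has exactly one $\Sigma$-fold point $A$, a visible fold of $X_1$ (the case of $X_2$ is obtained by exchanging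 $X_1,X_2$ and replacing $f$ by $-f$), that the positive $X_1$-orbit of $A$ runs in $f>0$ until it meets $\Sigma$ again, transversally, at a point $B$, and let $\gamma$ be this arc from $A$ to $B$. Let $[A,B]$ be an arc of $\Sigma$ with end points $A$ and $B$, with a smooth regular coordinate $c:[a,b]\to[A,B]$, $c(a)=A$, $c(b)=B$, and put $\Gamma=\gamma\cup[A,B]$. **Direction function.** For $z=c(s)\in[A,B]$ let $p(z)$ be the point where the straight line through $z+X_1(z)$ and $z+X_2(z)$ meets the tangent line of $\Sigma$ at $z$, and define $H(z)\in\mathbb R$ by $p(z)=z+H(z)\,c'(s)$ (if $\Sigma$ is the $x$-axis and $c(s)=(s,0)$, then $p(z)\in\Sigma$ and $H(z)=p(z)-z$). We say that $H$ is well defined on $[A,B]$ if $(A,B]$ is contained in the escaping or in the sliding region and $p(z)$ exists and is unique for every $z\in[A,B]$. **Topological equivalence.** The configurations of two such systems on $\Gamma$ and $\Gamma'$ are topologically equivalent if there is a homeomorphism $\Gamma\to\Gamma'$ that maps $\Gamma\cap\Sigma$ onto $\Gamma'\cap\Sigma'$ and maps the oriented orbits contained in $\Gamma$ of $X_1|_{\Sigma_+}$,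 of $X_2|_{\Sigma_-}$ and of $X_0^\Sigma$ (on the sliding and escaping regions) onto the oriented orbits of the same kind contained in $\Gamma'$. **Model configurations.** Take $U=\mathbb R^2$, $f(x,z)=z$, $X_1(x,z)=(x+z-1,-x+z-1)$. Then $A=(-1,0)$, and the point $B=(\beta,0)$ does not depend on $X_2$ below; $\beta>1$. 1. $X_2(x,z)=(-x^2+\frac32x-\frac12,\,1)$: the point $(1,0)\in(A,B)$ is a $\Sigma$-saddle-attractor $C$ with connected separatrices (loop $C\to A\to B\to C$). 2. $X_2=(0,2)$: the point $(1,0)\in(A,B)$ is a $\Sigma$-saddle; one separatrix goes to $A$ and along $\gamma$ to $B$, the other one goes along $\Sigma$ to $B$. 3. $X_2=(1-\beta,\,1+\beta)$: the pseudo equilibrium is $B$ itself (loop $B\to A\to B$). **Proposition 1.** In the setting above: 1. the configuration of $X_0$ on $\Gamma$ is topologically equivalent to the first model if and only if $H$ is well defined on $[A,B]$, $H$ has exactly one zero in $(A,B)$, and $H(B)<0$; 2. it is topologically equivalent to the second model if and only if $H$ is well defined on $[A,B]$, $H$ has exactly one zero in $(A,B)$, and $H(B)>0$; 3. it is topologically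 equivalent to the third model if and only if $H$ is well defined on $[A,B]$, $H$ has no zeros in $(A,B)$, and $H(B)=0$. -/

import Mathlib

open Set
open scoped ContDiff

noncomputable section

namespace NonSmooth

/-- A non-smooth vector field `X₀ = (X₁, X₂)` of class `C^r` on an open set `U` of the plane, with
switching curve `Σ = f⁻¹(0)`, where `f` is smooth on `U` and `0` is a regular value of `f`.
(Values outside `U` play no role.) -/
structure Field (r : ℕ∞) where
  U : Set (ℝ × ℝ)
  f : ℝ × ℝ → ℝ
  X₁ : ℝ × ℝ → ℝ × ℝ
  X₂ : ℝ × ℝ → ℝ × ℝ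
  isOpen_U : IsOpen U
  smooth_f : ContDiffOn ℝ ∞ f U
  regular_f : ∀ q ∈ U, f q = 0 → fderiv ℝ f q ≠ 0
  contDiff_X₁ : ContDiffOn ℝ r X₁ U
  contDiff_X₂ : ContDiffOn ℝ r X₂ U

/-- `X.f (q) = ⟨∇f(q), X(q)⟩`. -/
def lie (X : ℝ × ℝ → ℝ × ℝ) (f : ℝ × ℝ → ℝ) (q : ℝ × ℝ) : ℝ := fderiv ℝ f q (X q)

namespace Field

variable {r : ℕ∞} (Z : Field r)

/-- The switching curve. -/
def switching : Set (ℝ × ℝ) := {q | q ∈ Z.U ∧ Z.f q = 0}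

/-- The closed side `Σ₊ = {f ≥ 0}`, where `X₁` acts. -/
def upper : Set (ℝ × ℝ) := {q | q ∈ Z.U ∧ 0 ≤ Z.f q}

/-- The closed side `Σ₋ = {f ≤ 0}`, where `X₂` acts. -/
def lower : Set (ℝ × ℝ) := {q | q ∈ Z.U ∧ Z.f q ≤ 0}

/-- The escaping region. -/
def escaping : Set (ℝ × ℝ) :=
  {q | q ∈ Z.switching ∧ 0 < lie Z.X₁ Z.f q ∧ lie Z.X₂ Z.f q < 0}

/-- The sliding region. -/
def sliding : Set (ℝ × ℝ) :=
  {q | q ∈ Z.switching ∧ lie Z.X₁ Z.f q < 0 ∧ 0 < lie Z.X₂ Z.f q}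

/-- The sliding (or escaping) vector field `X₀^Σ`: the vector `m - q`, where `m` is the point of
the line through `q + X₁(q)` and `q + X₂(q)` for which `m - q` is tangent to `Σ`. It is meant at
the points `q` of `Σ` where `X₁.f(q) ≠ X₂.f(q)`; on the sliding and escaping regions `m` lies on
the segment. -/
def slidingField (q : ℝ × ℝ) : ℝ × ℝ :=
  (lie Z.X₂ Z.f q - lie Z.X₁ Z.f q)⁻¹ •
    (lie Z.X₂ Z.f q • Z.X₁ q - lie Z.X₁ Z.f q • Z.X₂ q)

/-- Contact points: `X₁.f · X₂.f = 0`, and `X₀^Σ` is defined and does not vanish. -/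
def IsContact (q : ℝ × ℝ) : Prop :=
  q ∈ Z.switching ∧ lie Z.X₁ Z.f q * lie Z.X₂ Z.f q = 0 ∧
    lie Z.X₁ Z.f q ≠ lie Z.X₂ Z.f q ∧ Z.slidingField q ≠ 0

/-- `Σ`-fold points of `X₀`: contact points that are folds of `X₁` or of `X₂`. -/
def IsFold (q : ℝ × ℝ) : Prop :=
  Z.IsContact q ∧
    ((lie Z.X₁ Z.f q = 0 ∧ lie Z.X₁ (lie Z.X₁ Z.f) q ≠ 0) ∨
      (lie Z.X₂ Z.f q = 0 ∧ lie Z.X₂ (lie Z.X₂ Z.f) q ≠ 0))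

/-- Visible `Σ`-fold points of `X₁`. -/
def IsVisibleFold (q : ℝ × ℝ) : Prop :=
  Z.IsContact q ∧ lie Z.X₁ Z.f q = 0 ∧ 0 < lie Z.X₁ (lie Z.X₁ Z.f) q

end Field

/-- The standing situation: `A = c a` is the only `Σ`-fold point of `X₀` and it is visible;
`γ` is the arc of `X₁` that starts at `A`, runs in `f > 0` and ends at its next point
`B = c b` on `Σ`, where it is transversal to `Σ`; and `c`, restricted to `[a, b]`, is a smooth
regular parametrization of an arc `[A, B]` of `Σ`, that is, a coordinate along `[A, B]`. If `Σ` is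
the `x`-axis one may take `c s = (s, 0)`. -/
structure Arc {r : ℕ∞} (Z : Field r) where
  a : ℝ
  b : ℝ
  c : ℝ → ℝ × ℝ
  T : ℝ
  γ : ℝ → ℝ × ℝ
  a_lt_b : a < b
  smooth_c : ∀ s ∈ Icc a b, ContDiffAt ℝ ∞ c s
  regular_c : ∀ s ∈ Icc a b, deriv c s ≠ 0
  injOn_c : InjOn c (Icc a b)
  c_mem : ∀ s ∈ Icc a b, c s ∈ Z.switching
  visibleFold : Z.IsVisibleFold (c a)
  only_fold : ∀ q, Z.IsFold q → q = c a
  T_pos : 0 < T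
  solution_γ : ∀ t ∈ Icc 0 T, HasDerivWithinAt γ (Z.X₁ (γ t)) (Icc 0 T) t
  γ_start : γ 0 = c a
  γ_end : γ T = c b
  γ_mem : ∀ t ∈ Ioo 0 T, γ t ∈ Z.U ∧ 0 < Z.f (γ t)
  transversal : lie Z.X₁ Z.f (c b) ≠ 0

/-- The positive semi-orbit of `x` under `V` within `S`: the end points of the solutions of
`q' = V(q)` on compact time intervals that start at `x` and stay in `S`. It is empty if `x ∉ S`. -/
def semiOrbit (V : ℝ × ℝ → ℝ × ℝ) (S : Set (ℝ × ℝ)) (x : ℝ × ℝ) : Set (ℝ × ℝ) :=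
  {y | ∃ T : ℝ, 0 ≤ T ∧ ∃ q : ℝ → ℝ × ℝ,
    (∀ t ∈ Icc 0 T, HasDerivWithinAt q (V (q t)) (Icc 0 T) t ∧ q t ∈ S) ∧ q 0 = x ∧ q T = y}

namespace Arc

variable {r : ℕ∞} {Z : Field r} (P : Arc Z)

/-- The closed curve `Γ = γ ∪ [A, B]`. -/
def curve : Set (ℝ × ℝ) := P.γ '' Icc 0 P.T ∪ P.c '' Icc P.a P.b

/-- The oriented arcs of `X₁|Σ₊` in `Γ`. -/
def orbit₁ (x : ℝ × ℝ) : Set (ℝ × ℝ) := semiOrbit Z.X₁ (P.curve ∩ Z.upper) x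

/-- The oriented arcs of `X₂|Σ₋` in `Γ`. -/
def orbit₂ (x : ℝ × ℝ) : Set (ℝ × ℝ) := semiOrbit Z.X₂ (P.curve ∩ Z.lower) x

/-- The oriented arcs of `X₀^Σ` in `Γ`. -/
def orbitSliding (x : ℝ × ℝ) : Set (ℝ × ℝ) :=
  semiOrbit Z.slidingField (P.curve ∩ (Z.escaping ∪ Z.sliding)) x

/-- The configurations of `X₀` on `Γ` and of `X₀'` on `Γ'` are topologically equivalent: some
homeomorphism of `Γ` onto `Γ'` maps `Γ ∩ Σ` onto `Γ' ∩ Σ'` and oriented arcs of `X₁|Σ₊`, of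
`X₂|Σ₋` and of `X₀^Σ` onto oriented arcs of the same kind. -/
def TopEquiv {Z' : Field r} (P : Arc Z) (P' : Arc Z') : Prop :=
  ∃ h : P.curve ≃ₜ P'.curve,
    (∀ x : P.curve, (x : ℝ × ℝ) ∈ Z.switching ↔ (h x : ℝ × ℝ) ∈ Z'.switching) ∧
    (∀ x y : P.curve, (y : ℝ × ℝ) ∈ P.orbit₁ x ↔ (h y : ℝ × ℝ) ∈ P'.orbit₁ (h x)) ∧
    (∀ x y : P.curve, (y : ℝ × ℝ) ∈ P.orbit₂ x ↔ (h y : ℝ × ℝ) ∈ P'.orbit₂ (h x)) ∧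
    (∀ x y : P.curve,
      (y : ℝ × ℝ) ∈ P.orbitSliding x ↔ (h y : ℝ × ℝ) ∈ P'.orbitSliding (h x))

/-- `v = H(z)` at the point `z = c s`: the straight line through `z + X₁(z)` and `z + X₂(z)` meets
the tangent line of `Σ` at `z` in the point `p(z) = z + v • c'(s)`. For `c s = (s, 0)` the tangent
line is `Σ`, the point is `p(z) = (s + v, 0)`, and `v` is the difference `p(z) - z`. -/
def IsDirection (s v : ℝ) : Prop :=
  P.c s + v • deriv P.c s ∈ line[ℝ, P.c s + Z.X₁ (P.c s), P.c s + Z.X₂ (P.c s)]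

/-- The direction function, as a function of the coordinate `s` of the point `z = c s`. -/
def H (s : ℝ) : ℝ := Classical.epsilon (fun v => P.IsDirection s v)

/-- The direction function is well defined on `[A, B]`: `(A, B]` is contained in the escaping or in
the sliding region, and at each point of `[A, B]` the point `p(z)` exists and is unique. -/
def HWellDefined : Prop :=
  ((∀ s ∈ Ioc P.a P.b, P.c s ∈ Z.escaping) ∨ (∀ s ∈ Ioc P.a P.b, P.c s ∈ Z.sliding)) ∧
    ∀ s ∈ Icc P.a P.b, ∃! v : ℝ, P.IsDirection s v

end Arc

/-- The system `X₁(x,z) = (x+z-1, -x+z-1)`, `X₂(x,z) = (g x, k)` on the plane, with `f(x,z) = z`. -/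
def modelField (r : ℕ∞) (g : ℝ → ℝ) (hg : ContDiff ℝ r g) (k : ℝ) : Field r where
  U := univ
  f := Prod.snd
  X₁ := fun q => (q.1 + q.2 - 1, -q.1 + q.2 - 1)
  X₂ := fun q => (g q.1, k)
  isOpen_U := isOpen_univ
  smooth_f := contDiff_snd.contDiffOn
  regular_f := by
    intro q _ _ h
    have h1 : fderiv ℝ (Prod.snd : ℝ × ℝ → ℝ) q = ContinuousLinearMap.snd ℝ ℝ ℝ := fderiv_snd
    rw [h1] at h
    have := congrArg (fun L : ℝ × ℝ →L[ℝ] ℝ => L (0, 1)) h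
    simp at this
  contDiff_X₁ := by
    apply ContDiff.contDiffOn
    fun_prop
  contDiff_X₂ := by
    apply ContDiff.contDiffOn
    exact (hg.comp contDiff_fst).prodMk contDiff_const

/-- First configuration, the explicit system with `X₂(x,z) = (-x² + 3x/2 - 1/2, 1)`: a
`Σ`-saddle-attractor at `(1, 0)` in `(A, B)` whose separatrices are connected (`C → A → B → C`). -/
def modelOne (r : ℕ∞) : Field r :=
  modelField r (fun x => -x ^ 2 + 3 / 2 * x - 1 / 2) (by fun_prop) 1

/-- The system with `X₂ = (1 - κ, 1 + κ)`; for `κ > -1` its only pseudo equilibrium in the sliding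
region `x > -1` is `(κ, 0)`, from which `X₀^Σ` points away on both sides. -/
def modelTwo (r : ℕ∞) (κ : ℝ) : Field r :=
  modelField r (fun _ => 1 - κ) contDiff_const (1 + κ)

namespace Arc

variable {r : ℕ∞} {Z : Field r} (P : Arc Z)

/-- First configuration: loop through a `Σ`-saddle-attractor in `(A, B)`. -/
def IsFirstConfiguration : Prop := ∃ P' : Arc (modelOne r), P.TopEquiv P'

/-- Second configuration: a `Σ`-saddle `C` in `(A, B)`, with one separatrix going to `A` and then
along `γ` to `B`, the other one going to `B` along `Σ`. -/
def IsSecondConfiguration : Prop := ∃ P' : Arc (modelTwo r 1), P.TopEquiv P'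

/-- Third configuration: loop through a pseudo equilibrium placed at `B` itself. -/
def IsThirdConfiguration : Prop :=
  ∃ κ : ℝ, ∃ P' : Arc (modelTwo r κ), P'.c P'.b = (κ, 0) ∧ P.TopEquiv P'

end Arc

end NonSmooth

end

/-!
In the coordinate `c` the sliding field is the scalar equation `s' = H(s)`, so the proposition says
that the equivalence class of a configuration is read off from the signs of `H` on `(A, B]`.

* `H` is well defined exactly if `(A, B]` lies in the sliding region (`hWellDefined_iff`): `γ` comes
  down to `B`, hence `X₁.f(B) < 0`, which excludes escaping. In that case `H(A) < 0`, because `A`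
  is a visible fold (`IsSliding.H_left_neg`).
* If `(A, B]` slides, all orbits within `Γ` are known. The orbit of `X₁` through a point of `γ` is
  the rest of `γ`; `X₁` on `(A, B]` and `X₂` on `[A, B]` point to the other side of `Σ`, so that
  their orbits there are points; and the sliding orbits are those of `s' = H(s)`, where an equilibrium is
  not reached in finite time, as the sliding field is `C¹` (`IsSliding.mem_orbitSliding`).
* Hence an increasing homeomorphism `[a, b] → [a', b']` that matches the signs of `H` and `H'`
  extends by a change of time on `γ` to an equivalence (`SameSigns.topEquiv`). Conversely, let `Γ'`
  slide and be equivalent to `Γ`. The points of `Γ' ∩ Σ'` without sliding orbit reduce to `A'`, and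
  `A` has no sliding orbit either; so `A` corresponds to `A'`, the arc `(A, B]` slides, and the
  sliding orbits determine the signs of `H` (`TopEquiv.isSliding_and_sameSigns`).
* In the models `H` has the sign of an explicit polynomial, and `B` lies to the right of `(1, 0)`
  since the orbits of `X₁` spiral out of the focus `(0, 1)` (`model_one_lt_right`). The arc `γ` of
  the models is given by an explicit solution (`exists_modelArc`). The three sign patterns are:
  one interior zero and `H(B) < 0`; one interior zero and `H(B) > 0`; no interior zero and
  `H(B) = 0`. Each of them, together with `H(A) < 0`, determines the signs on `(A, B]` up to an
  increasing change of the coordinate.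
-/

noncomputable section

open Set Topology Filter
open scoped ContDiff

namespace NonSmooth

/-! ### Ordinary differential equations in dimension one and two -/

/-- Two solutions of an autonomous `C¹` equation on the same compact interval coincide as soon as
they meet. -/
theorem eqOn_of_solutions {V : ℝ × ℝ → ℝ × ℝ} {W : Set (ℝ × ℝ)} (hW : IsOpen W)
    (hV : ContDiffOn ℝ 1 V W) {a b : ℝ} {p q : ℝ → ℝ × ℝ}
    (hp : ∀ t ∈ Icc a b, HasDerivWithinAt p (V (p t)) (Icc a b) t ∧ p t ∈ W)
    (hq : ∀ t ∈ Icc a b, HasDerivWithinAt q (V (q t)) (Icc a b) t ∧ q t ∈ W)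
    {t₀ : ℝ} (ht₀ : t₀ ∈ Icc a b) (h₀ : p t₀ = q t₀) : EqOn p q (Icc a b) := by
  have hpc : ContinuousOn p (Icc a b) := fun t ht => (hp t ht).1.continuousWithinAt
  have hqc : ContinuousOn q (Icc a b) := fun t ht => (hq t ht).1.continuousWithinAt
  -- The two trajectories form a compact set, on which `V` is Lipschitz.
  set K : Set (ℝ × ℝ) := p '' Icc a b ∪ q '' Icc a b with hK
  have hKc : IsCompact K :=
    (isCompact_Icc.image_of_continuousOn hpc).union (isCompact_Icc.image_of_continuousOn hqc)
  have hKW : K ⊆ W := by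
    rintro _ (⟨t, ht, rfl⟩ | ⟨t, ht, rfl⟩)
    exacts [(hp t ht).2, (hq t ht).2]
  have hloc : LocallyLipschitzOn K V := by
    intro x hx
    obtain ⟨L, t, ht, hL⟩ :=
      ((hV.contDiffAt (hW.mem_nhds (hKW hx))).exists_lipschitzOnWith)
    exact ⟨L, t, mem_nhdsWithin_of_mem_nhds ht, hL⟩
  obtain ⟨L, hL⟩ := hloc.exists_lipschitzOnWith_of_compact hKc
  have hpK : ∀ t ∈ Icc a b, p t ∈ K := fun t ht => Or.inl ⟨t, ht, rfl⟩
  have hqK : ∀ t ∈ Icc a b, q t ∈ K := fun t ht => Or.inr ⟨t, ht, rfl⟩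
  have hsubl : Icc a t₀ ⊆ Icc a b := Icc_subset_Icc_right ht₀.2
  have hsubr : Icc t₀ b ⊆ Icc a b := Icc_subset_Icc_left ht₀.1
  have hleft : EqOn p q (Icc a t₀) := by
    refine ODE_solution_unique_of_mem_Icc_left (v := fun _ => V) (s := fun _ => K) (K := L)
      (fun _ _ => hL) (hpc.mono hsubl) ?_ (fun t ht => hpK t (hsubl ⟨ht.1.le, ht.2⟩))
      (hqc.mono hsubl) ?_ (fun t ht => hqK t (hsubl ⟨ht.1.le, ht.2⟩)) h₀
    · exact fun t ht => (hp t (hsubl ⟨ht.1.le, ht.2⟩)).1.mono_of_mem_nhdsWithin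
        (Icc_mem_nhdsLE_of_mem ⟨ht.1, ht.2.trans ht₀.2⟩)
    · exact fun t ht => (hq t (hsubl ⟨ht.1.le, ht.2⟩)).1.mono_of_mem_nhdsWithin
        (Icc_mem_nhdsLE_of_mem ⟨ht.1, ht.2.trans ht₀.2⟩)
  have hright : EqOn p q (Icc t₀ b) := by
    refine ODE_solution_unique_of_mem_Icc_right (v := fun _ => V) (s := fun _ => K) (K := L)
      (fun _ _ => hL) (hpc.mono hsubr) ?_ (fun t ht => hpK t (hsubr ⟨ht.1, ht.2.le⟩))
      (hqc.mono hsubr) ?_ (fun t ht => hqK t (hsubr ⟨ht.1, ht.2.le⟩)) h₀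
    · exact fun t ht => (hp t (hsubr ⟨ht.1, ht.2.le⟩)).1.mono_of_mem_nhdsWithin
        (Icc_mem_nhdsGE_of_mem ⟨ht₀.1.trans ht.1, ht.2⟩)
    · exact fun t ht => (hq t (hsubr ⟨ht.1, ht.2.le⟩)).1.mono_of_mem_nhdsWithin
        (Icc_mem_nhdsGE_of_mem ⟨ht₀.1.trans ht.1, ht.2⟩)
  intro t ht
  rcases le_total t t₀ with h | h
  exacts [hleft ⟨ht.1, h⟩, hright ⟨h, ht.2⟩]

theorem deriv_nonneg_of_nonneg_right {g : ℝ → ℝ} {g' a b t : ℝ} (ht : t ∈ Ico a b)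
    (hg : HasDerivWithinAt g g' (Icc a b) t) (h0 : g t = 0) (h : ∀ u ∈ Ioo t b, 0 ≤ g u) :
    0 ≤ g' := by
  have h1 : HasDerivWithinAt g g' (Ioi t) t :=
    hg.mono_of_mem_nhdsWithin (mem_of_superset (Ioo_mem_nhdsGT ht.2)
      fun u hu => ⟨ht.1.trans hu.1.le, hu.2.le⟩)
  rw [hasDerivWithinAt_iff_tendsto_slope' (by simp)] at h1
  refine ge_of_tendsto h1 ?_
  filter_upwards [Ioo_mem_nhdsGT ht.2] with u hu
  rw [slope_def_field, h0, sub_zero]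
  exact div_nonneg (h u hu) (sub_nonneg.2 hu.1.le)

theorem deriv_nonpos_of_nonneg_left {g : ℝ → ℝ} {g' a b t : ℝ} (ht : t ∈ Ioc a b)
    (hg : HasDerivWithinAt g g' (Icc a b) t) (h0 : g t = 0) (h : ∀ u ∈ Ioo a t, 0 ≤ g u) :
    g' ≤ 0 := by
  have h1 : HasDerivWithinAt g g' (Iio t) t :=
    hg.mono_of_mem_nhdsWithin (mem_of_superset (Ioo_mem_nhdsLT ht.1)
      fun u hu => ⟨hu.1.le, hu.2.le.trans ht.2⟩)
  rw [hasDerivWithinAt_iff_tendsto_slope' (by simp)] at h1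
  refine le_of_tendsto h1 ?_
  filter_upwards [Ioo_mem_nhdsLT ht.1] with u hu
  rw [slope_def_field, h0, sub_zero]
  exact div_nonpos_of_nonneg_of_nonpos (h u hu) (sub_nonpos.2 hu.2.le)

/-- A scalar autonomous equation with positive right-hand side moves from `s` to any later `s'` in
finite time: the passage time is the integral of `1 / H`, and the solution is its inverse. -/
theorem exists_solution_of_pos {H : ℝ → ℝ} {s s' : ℝ} (h : s ≤ s')
    (hc : ContinuousOn H (Icc s s')) (hpos : ∀ u ∈ Icc s s', 0 < H u) :
    ∃ T : ℝ, 0 ≤ T ∧ ∃ y : ℝ → ℝ,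
      (∀ t ∈ Icc 0 T, HasDerivWithinAt y (H (y t)) (Icc 0 T) t ∧ y t ∈ Icc s s') ∧
        y 0 = s ∧ y T = s' := by
  set k : ℝ → ℝ := fun x => (H (projIcc s s' h x))⁻¹ with hk
  have hkpos : ∀ x, 0 < k x := fun x => inv_pos.2 (hpos _ (projIcc s s' h x).2)
  have hkc : Continuous k := by
    refine Continuous.inv₀ ?_ fun x => (hpos _ (projIcc s s' h x).2).ne'
    exact hc.comp_continuous (continuous_subtype_val.comp continuous_projIcc)
      fun x => (projIcc s s' h x).2
  set G : ℝ → ℝ := fun x => ∫ u in s..x, k u with hG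
  have hGd : ∀ x, HasStrictDerivAt G (k x) x := fun x =>
    intervalIntegral.integral_hasStrictDerivAt_right (hkc.intervalIntegrable _ _)
      hkc.stronglyMeasurable.stronglyMeasurableAtFilter hkc.continuousAt
  have hGm : StrictMono G := by
    refine strictMono_of_deriv_pos fun x => ?_
    rw [(hGd x).hasDerivAt.deriv]
    exact hkpos x
  have hGs : G s = 0 := intervalIntegral.integral_same
  have hGc : Continuous G := continuous_iff_continuousAt.2 fun x => (hGd x).hasDerivAt.continuousAt
  have hinv : Function.LeftInverse (Function.invFun G) G := Function.leftInverse_invFun hGm.injective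
  refine ⟨G s', hGs ▸ hGm.monotone h, Function.invFun G, ?_, ?_, hinv s'⟩
  · intro t ht
    obtain ⟨x, hx, rfl⟩ : t ∈ G '' Icc s s' := by
      apply intermediate_value_Icc h hGc.continuousOn
      rwa [hGs]
    rw [hinv x]
    refine ⟨HasDerivAt.hasDerivWithinAt ?_, hx⟩
    have hx' : H x = (k x)⁻¹ := by simp [hk, projIcc_of_mem h hx]
    rw [hx']
    refine ((hGd x).to_localInverse (hkpos x).ne').hasDerivAt.congr_of_eventuallyEq ?_
    have := ((hGd x).hasStrictFDerivAt_equiv (hkpos x).ne').eventually_right_inverse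
    filter_upwards [this] with z hz
    conv_lhs => rw [← hz]
    exact hinv _
  · rw [← hGs]
    exact hinv s

/-- Time reversal of `exists_solution_of_pos`. -/
theorem exists_solution_of_neg {H : ℝ → ℝ} {s s' : ℝ} (h : s' ≤ s)
    (hc : ContinuousOn H (Icc s' s)) (hneg : ∀ u ∈ Icc s' s, H u < 0) :
    ∃ T : ℝ, 0 ≤ T ∧ ∃ y : ℝ → ℝ,
      (∀ t ∈ Icc 0 T, HasDerivWithinAt y (H (y t)) (Icc 0 T) t ∧ y t ∈ Icc s' s) ∧
        y 0 = s ∧ y T = s' := by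
  obtain ⟨T, hT, y, hy, h0, h1⟩ := exists_solution_of_pos (H := fun u => -H u) h hc.neg
    fun u hu => neg_pos.2 (hneg u hu)
  refine ⟨T, hT, fun t => y (T - t), fun t ht => ?_, by simpa using h1, by simpa using h0⟩
  have hmaps : MapsTo (fun t : ℝ => T - t) (Icc 0 T) (Icc 0 T) := fun u hu =>
    ⟨sub_nonneg.2 hu.2, sub_le_self _ hu.1⟩
  refine ⟨?_, (hy _ (hmaps ht)).2⟩
  have := (hy _ (hmaps ht)).1.scomp t ((hasDerivWithinAt_id t (Icc 0 T)).const_sub T) hmaps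
  simpa using! this

/-- A continuous lift through a regular curve `c` of a differentiable motion along `c` is
differentiable. -/
theorem hasDerivWithinAt_lift {c q : ℝ → ℝ × ℝ} {y : ℝ → ℝ} {S : Set ℝ} {t v : ℝ} {c' : ℝ × ℝ}
    (ht : t ∈ S) (hc : HasStrictDerivAt c c' (y t)) (hc' : c' ≠ 0)
    (hy : ContinuousWithinAt y S t) (hq : EqOn q (c ∘ y) S)
    (hqd : HasDerivWithinAt q (v • c') S t) : HasDerivWithinAt y v S t := by
  obtain ⟨l, hl⟩ := SeparatingDual.exists_ne_zero (R := ℝ) hc'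
  have hg : HasStrictDerivAt (l ∘ c) (l c') (y t) := l.hasStrictFDerivAt.comp_hasStrictDerivAt _ hc
  have hinv := hg.to_localInverse hl
  have hleft := (hg.hasStrictFDerivAt_equiv hl).eventually_left_inverse
  have hlq : HasDerivWithinAt (l ∘ q) (l (v • c')) S t :=
    l.hasFDerivAt.comp_hasDerivWithinAt t hqd
  have hqt : (l ∘ c) (y t) = (l ∘ q) t := by simp [hq ht]
  rw [hqt] at hinv
  have := hinv.hasDerivAt.comp_hasDerivWithinAt t hlq
  have hv : (l c')⁻¹ * l (v • c') = v := by
    rw [map_smul, smul_eq_mul]; field_simp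
  rw [hv] at this
  refine this.congr_of_eventuallyEq_of_mem ?_ ht
  filter_upwards [hy.eventually hleft, self_mem_nhdsWithin] with u hu huS
  rw [Function.comp_apply, Function.comp_apply, hq huS]
  exact hu.symm

/-! ### The sliding field and the direction function -/

theorem contDiffOn_lie {r : ℕ∞} (hr : 1 ≤ r) {U : Set (ℝ × ℝ)} (hU : IsOpen U)
    {X : ℝ × ℝ → ℝ × ℝ} {f : ℝ × ℝ → ℝ} (hX : ContDiffOn ℝ r X U) (hf : ContDiffOn ℝ ∞ f U) :
    ContDiffOn ℝ 1 (lie X f) U := by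
  have h1 : ContDiffOn ℝ 1 (fderiv ℝ f) U := hf.fderiv_of_isOpen hU (by norm_cast)
  exact h1.clm_apply (hX.of_le (by exact_mod_cast hr))

/-- The kernel of a nonzero linear form on the plane is a line. -/
theorem exists_smul_eq_of_apply_eq_zero {L : ℝ × ℝ →L[ℝ] ℝ} (hL : L ≠ 0) {u w : ℝ × ℝ}
    (hu : L u = 0) (hw : L w = 0) (hw0 : w ≠ 0) : ∃ v : ℝ, v • w = u := by
  have hdec : ∀ z : ℝ × ℝ, L z = z.1 * L (1, 0) + z.2 * L (0, 1) := by
    intro z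
    have : z = z.1 • ((1 : ℝ), (0 : ℝ)) + z.2 • ((0 : ℝ), (1 : ℝ)) := by ext <;> simp
    conv_lhs => rw [this]
    rw [map_add, map_smul, map_smul, smul_eq_mul, smul_eq_mul]
  have hne : L (1, 0) ≠ 0 ∨ L (0, 1) ≠ 0 := by
    by_contra! h
    refine hL (ContinuousLinearMap.ext fun z => ?_)
    rw [hdec, h.1, h.2]
    simp
  rw [hdec] at hu hw
  have hdet : u.1 * w.2 = u.2 * w.1 := by
    rcases hne with h | h
    · apply mul_left_cancel₀ h
      linear_combination w.2 * hu - u.2 * hw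
    · apply mul_left_cancel₀ h
      linear_combination u.1 * hw - w.1 * hu
  have hw' : w.1 ≠ 0 ∨ w.2 ≠ 0 := by
    by_contra! h
    exact hw0 (Prod.ext h.1 h.2)
  rcases hw' with h | h
  · refine ⟨u.1 / w.1, Prod.ext ?_ ?_⟩
    · simp [h]
    · simp only [Prod.smul_snd, smul_eq_mul]
      field_simp
      linear_combination hdet
  · refine ⟨u.2 / w.2, Prod.ext ?_ ?_⟩
    · simp only [Prod.smul_fst, smul_eq_mul]
      field_simp
      linear_combination -hdet
    · simp [h]

namespace Field

variable {r : ℕ∞} (Z : Field r)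

/-- The open set on which the formula of the sliding field makes sense. -/
def slidingDomain : Set (ℝ × ℝ) := {q | q ∈ Z.U ∧ lie Z.X₁ Z.f q ≠ lie Z.X₂ Z.f q}

variable {Z}

theorem contDiffOn_lie₁ (hr : 1 ≤ r) : ContDiffOn ℝ 1 (lie Z.X₁ Z.f) Z.U :=
  contDiffOn_lie hr Z.isOpen_U Z.contDiff_X₁ Z.smooth_f

theorem contDiffOn_lie₂ (hr : 1 ≤ r) : ContDiffOn ℝ 1 (lie Z.X₂ Z.f) Z.U :=
  contDiffOn_lie hr Z.isOpen_U Z.contDiff_X₂ Z.smooth_f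

theorem isOpen_slidingDomain (hr : 1 ≤ r) : IsOpen Z.slidingDomain := by
  have h : ContinuousOn (fun q => lie Z.X₁ Z.f q - lie Z.X₂ Z.f q) Z.U :=
    (contDiffOn_lie₁ hr).continuousOn.sub (contDiffOn_lie₂ hr).continuousOn
  have := h.isOpen_inter_preimage Z.isOpen_U (isOpen_compl_singleton (x := (0 : ℝ)))
  convert this using 1
  ext q
  simp [slidingDomain, sub_eq_zero]

theorem contDiffOn_slidingField (hr : 1 ≤ r) :
    ContDiffOn ℝ 1 Z.slidingField Z.slidingDomain := by
  have hsub : Z.slidingDomain ⊆ Z.U := fun q hq => hq.1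
  have h1 := (contDiffOn_lie₁ (Z := Z) hr).mono hsub
  have h2 := (contDiffOn_lie₂ (Z := Z) hr).mono hsub
  have hr' : ((1 : ℕ∞) : WithTop ℕ∞) ≤ r := by exact_mod_cast hr
  have hX1 : ContDiffOn ℝ 1 Z.X₁ Z.slidingDomain := (Z.contDiff_X₁.mono hsub).of_le hr'
  have hX2 : ContDiffOn ℝ 1 Z.X₂ Z.slidingDomain := (Z.contDiff_X₂.mono hsub).of_le hr'
  exact ((h2.sub h1).inv fun q hq => sub_ne_zero.2 hq.2.symm).smul ((h2.smul hX1).sub (h1.smul hX2))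

theorem fderiv_slidingField (q : ℝ × ℝ) : fderiv ℝ Z.f q (Z.slidingField q) = 0 := by
  simp only [slidingField, map_smul, map_sub, smul_eq_mul, lie]
  ring

theorem hasFDerivAt_f {q : ℝ × ℝ} (hq : q ∈ Z.U) : HasFDerivAt Z.f (fderiv ℝ Z.f q) q :=
  ((Z.smooth_f.contDiffAt (Z.isOpen_U.mem_nhds hq)).differentiableAt (by simp)).hasFDerivAt

/-- Along a motion of `V`, the function `f` has derivative `V.f`. -/
theorem hasDerivWithinAt_f_comp {V : ℝ × ℝ → ℝ × ℝ} {q : ℝ → ℝ × ℝ} {S : Set ℝ} {t : ℝ}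
    (hU : q t ∈ Z.U) (hq : HasDerivWithinAt q (V (q t)) S t) :
    HasDerivWithinAt (Z.f ∘ q) (lie V Z.f (q t)) S t :=
  (hasFDerivAt_f hU).comp_hasDerivWithinAt t hq

end Field

namespace Arc

variable {r : ℕ∞} {Z : Field r} (P : Arc Z)

/-- The half-open arc `(A, B]` lies in the sliding region. -/
def IsSliding : Prop := ∀ s ∈ Ioc P.a P.b, P.c s ∈ Z.sliding

theorem left_mem : P.a ∈ Icc P.a P.b := left_mem_Icc.2 P.a_lt_b.le

theorem right_mem : P.b ∈ Icc P.a P.b := right_mem_Icc.2 P.a_lt_b.le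

variable {P}

theorem c_mem_U {s : ℝ} (hs : s ∈ Icc P.a P.b) : P.c s ∈ Z.U := (P.c_mem s hs).1

theorem f_c {s : ℝ} (hs : s ∈ Icc P.a P.b) : Z.f (P.c s) = 0 := (P.c_mem s hs).2

theorem hasStrictDerivAt_c {s : ℝ} (hs : s ∈ Icc P.a P.b) :
    HasStrictDerivAt P.c (deriv P.c s) s :=
  (P.smooth_c s hs).hasStrictDerivAt (by simp)

theorem continuousOn_c : ContinuousOn P.c (Icc P.a P.b) :=
  fun s hs => (P.smooth_c s hs).continuousAt.continuousWithinAt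

theorem fderiv_f_deriv_c {s : ℝ} (hs : s ∈ Icc P.a P.b) :
    fderiv ℝ Z.f (P.c s) (deriv P.c s) = 0 := by
  have h1 : HasDerivWithinAt (Z.f ∘ P.c) (fderiv ℝ Z.f (P.c s) (deriv P.c s)) (Icc P.a P.b) s :=
    (Field.hasFDerivAt_f (c_mem_U hs)).comp_hasDerivWithinAt s
      (hasStrictDerivAt_c hs).hasDerivAt.hasDerivWithinAt
  have h2 : HasDerivWithinAt (Z.f ∘ P.c) 0 (Icc P.a P.b) s :=
    (hasDerivWithinAt_const s (Icc P.a P.b) (0 : ℝ)).congr (fun u hu => f_c hu) (f_c hs)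
  exact UniqueDiffWithinAt.eq_deriv _ (uniqueDiffOn_Icc P.a_lt_b s hs) h1 h2

theorem isDirection_iff {s v : ℝ} (hs : s ∈ Icc P.a P.b)
    (hne : lie Z.X₁ Z.f (P.c s) ≠ lie Z.X₂ Z.f (P.c s)) :
    P.IsDirection s v ↔ v • deriv P.c s = Z.slidingField (P.c s) := by
  have hne' : lie Z.X₂ Z.f (P.c s) - lie Z.X₁ Z.f (P.c s) ≠ 0 := sub_ne_zero.2 hne.symm
  rw [IsDirection, mem_affineSpan_pair_iff_exists_lineMap_eq]
  simp only [AffineMap.lineMap_apply, vsub_eq_sub, vadd_eq_add, add_sub_add_left_eq_sub]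
  constructor
  · rintro ⟨t, ht⟩
    have hv : v • deriv P.c s = Z.X₁ (P.c s) + t • (Z.X₂ (P.c s) - Z.X₁ (P.c s)) := by
      linear_combination -ht
    have h0 := congrArg (fderiv ℝ Z.f (P.c s)) hv
    rw [map_smul, fderiv_f_deriv_c hs, map_add, map_smul, map_sub] at h0
    change v • (0 : ℝ) = lie Z.X₁ Z.f (P.c s)
      + t • (lie Z.X₂ Z.f (P.c s) - lie Z.X₁ Z.f (P.c s)) at h0
    simp only [smul_eq_mul, mul_zero] at h0
    have ht' : t = -lie Z.X₁ Z.f (P.c s) / (lie Z.X₂ Z.f (P.c s) - lie Z.X₁ Z.f (P.c s)) := by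
      rw [eq_div_iff hne']
      linear_combination -h0
    rw [hv, Field.slidingField, ht']
    ext <;> simp <;> field_simp <;> ring
  · intro hv
    refine ⟨-lie Z.X₁ Z.f (P.c s) / (lie Z.X₂ Z.f (P.c s) - lie Z.X₁ Z.f (P.c s)), ?_⟩
    rw [hv, Field.slidingField]
    ext <;> simp <;> field_simp <;> ring

theorem existsUnique_isDirection {s : ℝ} (hs : s ∈ Icc P.a P.b)
    (hne : lie Z.X₁ Z.f (P.c s) ≠ lie Z.X₂ Z.f (P.c s)) : ∃! v : ℝ, P.IsDirection s v := by
  obtain ⟨v, hv⟩ := exists_smul_eq_of_apply_eq_zero (Z.regular_f _ (c_mem_U hs) (f_c hs))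
    (Field.fderiv_slidingField (P.c s)) (fderiv_f_deriv_c hs) (P.regular_c s hs)
  refine ⟨v, (isDirection_iff hs hne).2 hv, fun w hw => ?_⟩
  have := ((isDirection_iff hs hne).1 hw).trans hv.symm
  exact smul_left_injective ℝ (P.regular_c s hs) this

/-- In the coordinate `c`, the sliding field is `H`. -/
theorem H_smul {s : ℝ} (hs : s ∈ Icc P.a P.b)
    (hne : lie Z.X₁ Z.f (P.c s) ≠ lie Z.X₂ Z.f (P.c s)) :
    P.H s • deriv P.c s = Z.slidingField (P.c s) :=
  (isDirection_iff hs hne).1 (Classical.epsilon_spec (existsUnique_isDirection hs hne).exists)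

theorem gamma_mem_U {t : ℝ} (ht : t ∈ Icc 0 P.T) : P.γ t ∈ Z.U := by
  rcases eq_or_lt_of_le ht.1 with rfl | h0
  · rw [P.γ_start]
    exact c_mem_U P.left_mem
  rcases eq_or_lt_of_le ht.2 with rfl | h1
  · rw [P.γ_end]
    exact c_mem_U P.right_mem
  exact (P.γ_mem t ⟨h0, h1⟩).1

theorem continuousOn_gamma : ContinuousOn P.γ (Icc 0 P.T) :=
  fun t ht => (P.solution_γ t ht).continuousWithinAt

/-- The arc `γ` reaches `B` from `f > 0`, and it does so transversally. -/
theorem lie_right_neg : lie Z.X₁ Z.f (P.c P.b) < 0 := by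
  refine lt_of_le_of_ne ?_ P.transversal
  have hT : P.T ∈ Icc 0 P.T := right_mem_Icc.2 P.T_pos.le
  have h := Field.hasDerivWithinAt_f_comp (gamma_mem_U hT) (P.solution_γ P.T hT)
  rw [← P.γ_end]
  refine deriv_nonpos_of_nonneg_left ⟨P.T_pos, le_rfl⟩ h ?_ fun u hu => (P.γ_mem u hu).2.le
  rw [Function.comp_apply, P.γ_end]
  exact f_c P.right_mem

theorem lie_left : lie Z.X₁ Z.f (P.c P.a) = 0 := P.visibleFold.2.1

theorem left_ne_right : P.c P.a ≠ P.c P.b := fun h =>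
  P.a_lt_b.ne (P.injOn_c P.left_mem P.right_mem h)

theorem IsSliding.lie_ne (hP : P.IsSliding) {s : ℝ} (hs : s ∈ Icc P.a P.b) :
    lie Z.X₁ Z.f (P.c s) ≠ lie Z.X₂ Z.f (P.c s) := by
  rcases eq_or_lt_of_le hs.1 with rfl | h
  · exact P.visibleFold.1.2.2.1
  · exact ((hP s ⟨h, hs.2⟩).2.1.trans (hP s ⟨h, hs.2⟩).2.2).ne

theorem hWellDefined_iff : P.HWellDefined ↔ P.IsSliding := by
  constructor
  · rintro ⟨h | h, -⟩
    · exact absurd lie_right_neg (h P.b ⟨P.a_lt_b, le_rfl⟩).2.1.le.not_gt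
    · exact h
  · exact fun h => ⟨Or.inr h, fun s hs => existsUnique_isDirection hs (h.lie_ne hs)⟩

theorem continuousOn_lie₁_c (hr : 1 ≤ r) :
    ContinuousOn (fun s => lie Z.X₁ Z.f (P.c s)) (Icc P.a P.b) :=
  (Field.contDiffOn_lie₁ hr).continuousOn.comp continuousOn_c fun _ hs => c_mem_U hs

theorem continuousOn_lie₂_c (hr : 1 ≤ r) :
    ContinuousOn (fun s => lie Z.X₂ Z.f (P.c s)) (Icc P.a P.b) :=
  (Field.contDiffOn_lie₂ hr).continuousOn.comp continuousOn_c fun _ hs => c_mem_U hs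

theorem IsSliding.c_mem_slidingDomain (hP : P.IsSliding) {s : ℝ} (hs : s ∈ Icc P.a P.b) :
    P.c s ∈ Z.slidingDomain := ⟨c_mem_U hs, hP.lie_ne hs⟩

theorem IsSliding.continuousOn_H (hr : 1 ≤ r) (hP : P.IsSliding) :
    ContinuousOn P.H (Icc P.a P.b) := by
  have hV : ContinuousOn (fun s => Z.slidingField (P.c s)) (Icc P.a P.b) :=
    (Field.contDiffOn_slidingField hr).continuousOn.comp continuousOn_c
      fun s hs => hP.c_mem_slidingDomain hs
  have hd : ContinuousOn (deriv P.c) (Icc P.a P.b) := fun s hs => by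
    have := ((P.smooth_c s hs).continuousAt_fderiv (by simp)).clm_apply
      (continuousAt_const (y := (1 : ℝ)))
    simpa only [fderiv_apply_one_eq_deriv] using this.continuousWithinAt
  have hne : ∀ s ∈ Icc P.a P.b, (deriv P.c s).1 ^ 2 + (deriv P.c s).2 ^ 2 ≠ 0 := by
    intro s hs h
    refine P.regular_c s hs (Prod.ext ?_ ?_) <;> simp <;> nlinarith [sq_nonneg (deriv P.c s).1,
      sq_nonneg (deriv P.c s).2]
  -- `H` is the coefficient of the orthogonal projection of the sliding field to `c'`.
  have hcont : ContinuousOn (fun s => ((Z.slidingField (P.c s)).1 * (deriv P.c s).1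
      + (Z.slidingField (P.c s)).2 * (deriv P.c s).2)
      / ((deriv P.c s).1 ^ 2 + (deriv P.c s).2 ^ 2)) (Icc P.a P.b) :=
    ((hV.fst.mul hd.fst).add (hV.snd.mul hd.snd)).div ((hd.fst.pow 2).add (hd.snd.pow 2)) hne
  refine hcont.congr fun s hs => ?_
  rw [eq_div_iff (hne s hs), ← H_smul hs (hP.lie_ne hs)]
  simp only [Prod.smul_fst, Prod.smul_snd, smul_eq_mul]
  ring

/-- At the visible fold `A` the sliding field is `X₁(A)`, along which `X₁.f` increases; as `X₁.f`
decreases from `0` along `(A, B]`, the field points out of `[A, B]`. -/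
theorem IsSliding.H_left_neg (hr : 1 ≤ r) (hP : P.IsSliding) : P.H P.a < 0 := by
  have hH := H_smul P.left_mem (hP.lie_ne P.left_mem)
  have hne := hP.lie_ne P.left_mem
  have hX : Z.slidingField (P.c P.a) = Z.X₁ (P.c P.a) := by
    rw [lie_left] at hne
    rw [Field.slidingField, lie_left, sub_zero, zero_smul, sub_zero, smul_smul,
      inv_mul_cancel₀ hne.symm, one_smul]
  have hd := ((Field.contDiffOn_lie₁ (Z := Z) hr).contDiffAt
    (Z.isOpen_U.mem_nhds (c_mem_U P.left_mem))).differentiableAt (by simp)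
  have hv := P.visibleFold.2.2
  rw [lie, ← hX, ← hH, map_smul, smul_eq_mul] at hv
  have h1 : HasDerivWithinAt (lie Z.X₁ Z.f ∘ P.c)
      (fderiv ℝ (lie Z.X₁ Z.f) (P.c P.a) (deriv P.c P.a)) (Icc P.a P.b) P.a :=
    hd.hasFDerivAt.comp_hasDerivWithinAt _
      (hasStrictDerivAt_c P.left_mem).hasDerivAt.hasDerivWithinAt
  have h2 := deriv_nonneg_of_nonneg_right ⟨le_rfl, P.a_lt_b⟩ h1.neg (by simp [lie_left])
    fun u hu => by simpa using (hP u ⟨hu.1, hu.2.le⟩).2.1.le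
  nlinarith

end Arc

/-! ### Orbits contained in the closed curve -/

/-- A continuous motion along an injective arc has a continuous coordinate. -/
theorem continuousOn_lift {α : Type*} [TopologicalSpace α] {a b : ℝ} {c : ℝ → ℝ × ℝ}
    (hc : ContinuousOn c (Icc a b)) (hi : InjOn c (Icc a b)) {y : α → ℝ} {S : Set α}
    (hy : MapsTo y S (Icc a b)) (h : ContinuousOn (c ∘ y) S) : ContinuousOn y S := by
  have hemb : IsClosedEmbedding (fun s : Icc a b => c s) :=
    (continuousOn_iff_continuous_domRestrict.1 hc).isClosedEmbedding (injOn_iff_injective.1 hi)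
  have h1 : Continuous (hy.restrict y S (Icc a b)) := by
    rw [hemb.continuous_iff]
    exact continuousOn_iff_continuous_domRestrict.1 h
  exact continuousOn_iff_continuous_domRestrict.2 (continuous_subtype_val.comp h1)

theorem le_of_deriv_nonneg {y y' : ℝ → ℝ} {a b : ℝ} (hab : a ≤ b)
    (hy : ∀ t ∈ Icc a b, HasDerivWithinAt y (y' t) (Icc a b) t) (h0 : ∀ t ∈ Icc a b, 0 ≤ y' t) :
    y a ≤ y b := by
  refine monotoneOn_of_deriv_nonneg (convex_Icc a b) (fun t ht => (hy t ht).continuousWithinAt)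
    (fun t ht => ?_) (fun t ht => ?_) (left_mem_Icc.2 hab) (right_mem_Icc.2 hab) hab
  · rw [interior_Icc] at ht ⊢
    exact ((hy t (Ioo_subset_Icc_self ht)).mono Ioo_subset_Icc_self).differentiableWithinAt
  · rw [interior_Icc] at ht
    rw [((hy t (Ioo_subset_Icc_self ht)).hasDerivAt (Icc_mem_nhds ht.1 ht.2)).deriv]
    exact h0 t (Ioo_subset_Icc_self ht)

section semiOrbit

variable {V : ℝ × ℝ → ℝ × ℝ} {S : Set (ℝ × ℝ)} {x y : ℝ × ℝ}

theorem mem_semiOrbit_self (hx : x ∈ S) : x ∈ semiOrbit V S x := by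
  refine ⟨0, le_rfl, fun _ => x, fun t ht => ⟨?_, hx⟩, rfl, rfl⟩
  rw [Icc_self] at ht ⊢
  rw [mem_singleton_iff.1 ht]
  exact HasFDerivWithinAt.singleton

theorem left_mem_of_mem_semiOrbit (h : y ∈ semiOrbit V S x) : x ∈ S := by
  obtain ⟨T, hT, q, hq, rfl, rfl⟩ := h
  exact (hq 0 (left_mem_Icc.2 hT)).2

theorem right_mem_of_mem_semiOrbit (h : y ∈ semiOrbit V S x) : y ∈ S := by
  obtain ⟨T, hT, q, hq, rfl, rfl⟩ := h
  exact (hq T (right_mem_Icc.2 hT)).2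

/-- A motion that stays on one side of `Σ`, namely in `ε f ≥ 0`, stops where the field points
strictly to the other side. -/
theorem eq_of_mem_semiOrbit_of_exit {r : ℕ∞} {Z : Field r} {ε : ℝ}
    (hS : ∀ q ∈ S, q ∈ Z.U ∧ 0 ≤ ε * Z.f q) (hx : Z.f x = 0) (hlie : ε * lie V Z.f x < 0)
    (h : y ∈ semiOrbit V S x) : y = x := by
  obtain ⟨T, hT, q, hq, rfl, rfl⟩ := h
  rcases eq_or_lt_of_le hT with rfl | hT'
  · rfl
  have h0 : (0 : ℝ) ∈ Icc 0 T := left_mem_Icc.2 hT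
  have hd := (Field.hasDerivWithinAt_f_comp (Z := Z) (hS _ (hq 0 h0).2).1 (hq 0 h0).1).const_mul ε
  have := deriv_nonneg_of_nonneg_right ⟨le_rfl, hT'⟩ hd (by simp [hx])
    fun u hu => (hS _ (hq u (Ioo_subset_Icc_self hu)).2).2
  exact absurd hlie this.not_gt

end semiOrbit

namespace Arc

variable {r : ℕ∞} {Z : Field r} {P : Arc Z}

theorem c_mem_curve {s : ℝ} (hs : s ∈ Icc P.a P.b) : P.c s ∈ P.curve := Or.inr ⟨s, hs, rfl⟩

theorem gamma_mem_curve {t : ℝ} (ht : t ∈ Icc 0 P.T) : P.γ t ∈ P.curve := Or.inl ⟨t, ht, rfl⟩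

theorem f_gamma_pos {t : ℝ} (ht : t ∈ Ioo 0 P.T) : 0 < Z.f (P.γ t) := (P.γ_mem t ht).2

theorem f_gamma_nonneg {t : ℝ} (ht : t ∈ Icc 0 P.T) : 0 ≤ Z.f (P.γ t) := by
  rcases eq_or_lt_of_le ht.1 with rfl | h0
  · rw [P.γ_start, f_c P.left_mem]
  rcases eq_or_lt_of_le ht.2 with rfl | h1
  · rw [P.γ_end, f_c P.right_mem]
  exact (f_gamma_pos ⟨h0, h1⟩).le

theorem mem_curve_switching {x : ℝ × ℝ} :
    x ∈ P.curve ∧ x ∈ Z.switching ↔ ∃ s ∈ Icc P.a P.b, P.c s = x := by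
  constructor
  · rintro ⟨⟨t, ht, rfl⟩ | ⟨s, hs, rfl⟩, hx⟩
    · rcases eq_or_lt_of_le ht.1 with rfl | h0
      · exact ⟨P.a, P.left_mem, P.γ_start.symm⟩
      rcases eq_or_lt_of_le ht.2 with rfl | h1
      · exact ⟨P.b, P.right_mem, P.γ_end.symm⟩
      · exact absurd hx.2 (f_gamma_pos ⟨h0, h1⟩).ne'
    · exact ⟨s, hs, rfl⟩
  · rintro ⟨s, hs, rfl⟩
    exact ⟨c_mem_curve hs, P.c_mem s hs⟩

theorem curve_subset_upper : P.curve ⊆ Z.upper := by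
  rintro _ (⟨t, ht, rfl⟩ | ⟨s, hs, rfl⟩)
  · exact ⟨gamma_mem_U ht, f_gamma_nonneg ht⟩
  · exact ⟨c_mem_U hs, (f_c hs).ge⟩

theorem contDiffOn_X₁ (hr : 1 ≤ r) : ContDiffOn ℝ 1 Z.X₁ Z.U :=
  Z.contDiff_X₁.of_le (by exact_mod_cast hr)

/-- The translate of `γ` that starts at `γ t` is a solution. -/
theorem hasDerivWithinAt_gamma_shift {t m v : ℝ} (ht : 0 ≤ t) (hm : t + m ≤ P.T)
    (hv : v ∈ Icc 0 m) :
    HasDerivWithinAt (fun v => P.γ (t + v)) (Z.X₁ (P.γ (t + v))) (Icc 0 m) v ∧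
      t + v ∈ Icc 0 P.T := by
  have hmaps : MapsTo (fun v : ℝ => t + v) (Icc 0 m) (Icc 0 P.T) := fun u hu =>
    ⟨add_nonneg ht hu.1, (add_le_add_right hu.2 t).trans hm⟩
  refine ⟨?_, hmaps hv⟩
  have := (P.solution_γ _ (hmaps hv)).scomp v ((hasDerivWithinAt_id v (Icc 0 m)).const_add t) hmaps
  simpa using! this

theorem gamma_injOn (hr : 1 ≤ r) : InjOn P.γ (Icc 0 P.T) := by
  -- If `γ` passed twice through a point, it would have been at `B` before the time `T`.
  have key : ∀ t ∈ Icc 0 P.T, ∀ u ∈ Icc 0 P.T, t < u → P.γ t ≠ P.γ u := by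
    intro t ht u hu htu h
    have hsol := eqOn_of_solutions Z.isOpen_U (contDiffOn_X₁ hr) (a := 0) (b := P.T - u)
      (p := fun v => P.γ (t + v)) (q := fun v => P.γ (u + v)) (t₀ := 0)
      (fun v hv => ?_) (fun v hv => ?_) (left_mem_Icc.2 (sub_nonneg.2 hu.2)) (by simpa using h)
    · have h1 := hsol (right_mem_Icc.2 (sub_nonneg.2 hu.2))
      simp only [add_sub_cancel] at h1
      rw [P.γ_end] at h1
      rcases eq_or_lt_of_le (show 0 ≤ t + (P.T - u) by linarith [ht.1, hu.2]) with h2 | h2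
      · rw [← h2, P.γ_start] at h1
        exact left_ne_right h1
      · have := f_gamma_pos (P := P) ⟨h2, by linarith⟩
        rw [h1, f_c P.right_mem] at this
        exact lt_irrefl _ this
    · have := hasDerivWithinAt_gamma_shift (P := P) ht.1 (by linarith) hv
      exact ⟨this.1, gamma_mem_U this.2⟩
    · have := hasDerivWithinAt_gamma_shift (P := P) hu.1 (by linarith) hv
      exact ⟨this.1, gamma_mem_U this.2⟩
  intro t ht u hu h
  rcases lt_trichotomy t u with h1 | h1 | h1
  exacts [absurd h (key t ht u hu h1), h1, absurd h.symm (key u hu t ht h1)]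

theorem gamma_eq_c_iff {t s : ℝ} (ht : t ∈ Icc 0 P.T) (hs : s ∈ Icc P.a P.b) :
    P.γ t = P.c s ↔ (t = 0 ∧ s = P.a) ∨ (t = P.T ∧ s = P.b) := by
  constructor
  · intro h
    rcases eq_or_lt_of_le ht.1 with h0 | h0
    · rw [← h0, P.γ_start] at h
      exact Or.inl ⟨h0.symm, (P.injOn_c P.left_mem hs h).symm⟩
    rcases eq_or_lt_of_le ht.2 with h1 | h1
    · rw [h1, P.γ_end] at h
      exact Or.inr ⟨h1, (P.injOn_c P.right_mem hs h).symm⟩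
    have := f_gamma_pos (P := P) ⟨h0, h1⟩
    rw [h, f_c hs] at this
    exact absurd this (lt_irrefl _)
  · rintro (⟨rfl, rfl⟩ | ⟨rfl, rfl⟩)
    exacts [P.γ_start, P.γ_end]

/-- Within `Γ`, the orbit of `X₁` through a point of `γ` is the rest of `γ`. -/
theorem mem_orbit₁_gamma (hr : 1 ≤ r) {t : ℝ} (ht : t ∈ Icc 0 P.T) {y : ℝ × ℝ} :
    y ∈ P.orbit₁ (P.γ t) ↔ ∃ u ∈ Icc t P.T, P.γ u = y := by
  constructor
  · rintro ⟨τ, hτ, q, hq, h0, rfl⟩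
    have hsol := eqOn_of_solutions Z.isOpen_U (contDiffOn_X₁ hr) (a := 0) (b := min τ (P.T - t))
      (p := q) (q := fun v => P.γ (t + v)) (t₀ := 0)
      (fun v hv => ?_) (fun v hv => ?_) (left_mem_Icc.2 (le_min hτ (sub_nonneg.2 ht.2)))
      (by simpa using h0)
    · rcases le_or_gt τ (P.T - t) with h | h
      · rw [min_eq_left h] at hsol
        exact ⟨t + τ, ⟨by linarith, by linarith⟩, (hsol (right_mem_Icc.2 hτ)).symm⟩
      · -- After its arrival at `B` the motion would leave `f ≥ 0`.
        exfalso
        rw [min_eq_right h.le] at hsol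
        have hB : q (P.T - t) = P.c P.b := by
          simp [hsol (right_mem_Icc.2 (sub_nonneg.2 ht.2)), P.γ_end]
        have hmem : P.T - t ∈ Icc 0 τ := ⟨sub_nonneg.2 ht.2, h.le⟩
        have hd := Field.hasDerivWithinAt_f_comp (Z := Z) (hq _ hmem).2.2.1 (hq _ hmem).1
        have := deriv_nonneg_of_nonneg_right ⟨hmem.1, h⟩ hd
          (by rw [Function.comp_apply, hB, f_c P.right_mem])
          fun u hu => (hq u ⟨hmem.1.trans hu.1.le, hu.2.le⟩).2.2.2
        rw [hB] at this
        exact this.not_gt lie_right_neg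
    · have hv' : v ∈ Icc 0 τ := ⟨hv.1, hv.2.trans (min_le_left _ _)⟩
      exact ⟨(hq v hv').1.mono (Icc_subset_Icc_right (min_le_left _ _)), (hq v hv').2.2.1⟩
    · have := hasDerivWithinAt_gamma_shift (P := P) ht.1
        (by linarith [min_le_right τ (P.T - t)]) hv
      exact ⟨this.1, gamma_mem_U this.2⟩
  · rintro ⟨u, hu, rfl⟩
    refine ⟨u - t, sub_nonneg.2 hu.1, fun v => P.γ (t + v), fun v hv => ?_, by simp, by simp⟩
    have := hasDerivWithinAt_gamma_shift (P := P) ht.1 (by linarith [hu.2]) hv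
    exact ⟨this.1, gamma_mem_curve this.2, curve_subset_upper (gamma_mem_curve this.2)⟩

theorem IsSliding.mem_orbit₁_c (hP : P.IsSliding) {s : ℝ} (hs : s ∈ Ioc P.a P.b) {y : ℝ × ℝ} :
    y ∈ P.orbit₁ (P.c s) ↔ y = P.c s := by
  have hs' := Ioc_subset_Icc_self hs
  constructor
  · refine eq_of_mem_semiOrbit_of_exit (Z := Z) (ε := 1) (fun q hq => ?_) (f_c hs') ?_
    · exact ⟨hq.2.1, by simpa using hq.2.2⟩
    · simpa using (hP s hs).2.1
  · rintro rfl
    exact mem_semiOrbit_self ⟨c_mem_curve hs', curve_subset_upper (c_mem_curve hs')⟩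

theorem IsSliding.lie₂_pos (hr : 1 ≤ r) (hP : P.IsSliding) {s : ℝ} (hs : s ∈ Icc P.a P.b) :
    0 < lie Z.X₂ Z.f (P.c s) := by
  rcases eq_or_lt_of_le hs.1 with rfl | h
  · refine lt_of_le_of_ne ?_ (lie_left ▸ hP.lie_ne hs)
    have h1 : Tendsto (fun s => lie Z.X₂ Z.f (P.c s)) (𝓝[Ioc P.a P.b] P.a)
        (𝓝 (lie Z.X₂ Z.f (P.c P.a))) :=
      (continuousOn_lie₂_c hr P.a P.left_mem).mono Ioc_subset_Icc_self
    have : (𝓝[Ioc P.a P.b] P.a).NeBot := by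
      rw [nhdsWithin_Ioc_eq_nhdsGT P.a_lt_b]
      infer_instance
    exact ge_of_tendsto h1 (eventually_mem_nhdsWithin.mono fun u hu => (hP u hu).2.2.le)
  · exact (hP s ⟨h, hs.2⟩).2.2

/-- Within `Γ`, the orbits of `X₂` are the points of `[A, B]`. -/
theorem IsSliding.mem_orbit₂ (hr : 1 ≤ r) (hP : P.IsSliding) {x y : ℝ × ℝ} :
    y ∈ P.orbit₂ x ↔ y = x ∧ ∃ s ∈ Icc P.a P.b, P.c s = x := by
  constructor
  · intro h
    have hx := left_mem_of_mem_semiOrbit h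
    have hx' : x ∈ P.curve ∧ x ∈ Z.switching :=
      ⟨hx.1, hx.2.1, le_antisymm hx.2.2 (curve_subset_upper hx.1).2⟩
    obtain ⟨s, hs, rfl⟩ := mem_curve_switching.1 hx'
    refine ⟨?_, s, hs, rfl⟩
    refine eq_of_mem_semiOrbit_of_exit (Z := Z) (ε := -1) (fun q hq => ?_) (f_c hs) ?_ h
    · exact ⟨hq.2.1, by linarith [hq.2.2]⟩
    · linarith [hP.lie₂_pos hr hs]
  · rintro ⟨rfl, s, hs, rfl⟩
    exact mem_semiOrbit_self ⟨c_mem_curve hs, c_mem_U hs, (f_c hs).le⟩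

theorem IsSliding.mem_curve_sliding (hP : P.IsSliding) {x : ℝ × ℝ} :
    x ∈ P.curve ∩ (Z.escaping ∪ Z.sliding) ↔ ∃ s ∈ Ioc P.a P.b, P.c s = x := by
  constructor
  · rintro ⟨hx, hx'⟩
    have hsw : x ∈ Z.switching := hx'.elim (fun h => h.1) (fun h => h.1)
    obtain ⟨s, hs, rfl⟩ := mem_curve_switching.1 ⟨hx, hsw⟩
    refine ⟨s, ⟨lt_of_le_of_ne hs.1 ?_, hs.2⟩, rfl⟩
    rintro rfl
    rcases hx' with h | h
    exacts [h.2.1.ne' lie_left, h.2.1.ne lie_left]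
  · rintro ⟨s, hs, rfl⟩
    exact ⟨c_mem_curve (Ioc_subset_Icc_self hs), Or.inr (hP s hs)⟩

end Arc

/-- The scalar equation `s' = H(s)` leads from `s` to `s'` in finite time: either the points
coincide, or `H` has the sign of `s' - s` on the closed interval between them. -/
def Moves (H : ℝ → ℝ) (s s' : ℝ) : Prop :=
  s = s' ∨ (s < s' ∧ ∀ u ∈ Icc s s', 0 < H u) ∨ (s' < s ∧ ∀ u ∈ Icc s' s, H u < 0)

namespace Arc

variable {r : ℕ∞} {Z : Field r} {P : Arc Z}

/-- In the coordinate `c`, the orbits of the sliding field are those of `H`. An equilibrium is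
neither left nor reached in finite time, since the sliding field is `C¹`. -/
theorem IsSliding.mem_orbitSliding (hr : 1 ≤ r) (hP : P.IsSliding) {s s' : ℝ}
    (hs : s ∈ Ioc P.a P.b) (hs' : s' ∈ Ioc P.a P.b) :
    P.c s' ∈ P.orbitSliding (P.c s) ↔ Moves P.H s s' := by
  constructor
  · rintro ⟨τ, hτ, q, hq, h0, h1⟩
    by_cases hss : s = s'
    · exact Or.inl hss
    have hlift : ∀ t ∈ Icc 0 τ, ∃ u, u ∈ Ioc P.a P.b ∧ P.c u = q t := fun t ht =>
      hP.mem_curve_sliding.1 (hq t ht).2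
    choose! y hy hyq using hlift
    have hyI : MapsTo y (Icc 0 τ) (Icc P.a P.b) := fun t ht => Ioc_subset_Icc_self (hy t ht)
    have hqc : ContinuousOn q (Icc 0 τ) := fun t ht => (hq t ht).1.continuousWithinAt
    have hyc : ContinuousOn y (Icc 0 τ) :=
      continuousOn_lift continuousOn_c P.injOn_c hyI (hqc.congr hyq)
    have hfield : ∀ t ∈ Icc 0 τ, Z.slidingField (q t) = P.H (y t) • deriv P.c (y t) := fun t ht => by
      rw [H_smul (hyI ht) (hP.lie_ne (hyI ht)), hyq t ht]
    have hyd : ∀ t ∈ Icc 0 τ, HasDerivWithinAt y (P.H (y t)) (Icc 0 τ) t := fun t ht => by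
      refine hasDerivWithinAt_lift ht (hasStrictDerivAt_c (hyI ht)) (P.regular_c _ (hyI ht))
        (hyc t ht) (fun u hu => (hyq u hu).symm) ?_
      rw [← hfield t ht]
      exact (hq t ht).1
    have m0 : (0 : ℝ) ∈ Icc 0 τ := left_mem_Icc.2 hτ
    have mτ : τ ∈ Icc 0 τ := right_mem_Icc.2 hτ
    have hy0 : y 0 = s :=
      P.injOn_c (hyI m0) (Ioc_subset_Icc_self hs) ((hyq 0 m0).trans h0)
    have hyτ : y τ = s' :=
      P.injOn_c (hyI mτ) (Ioc_subset_Icc_self hs') ((hyq τ mτ).trans h1)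
    have hne : ∀ t ∈ Icc 0 τ, P.H (y t) ≠ 0 := by
      intro t ht h
      have hzero : Z.slidingField (q t) = 0 := by rw [hfield t ht, h, zero_smul]
      have hdom : ∀ u ∈ Icc 0 τ, q u ∈ Z.slidingDomain := fun u hu => by
        rw [← hyq u hu]
        exact hP.c_mem_slidingDomain (hyI hu)
      have hconst := eqOn_of_solutions (Field.isOpen_slidingDomain hr)
        (Field.contDiffOn_slidingField hr) (p := q) (q := fun _ => q t)
        (fun u hu => ⟨(hq u hu).1, hdom u hu⟩)
        (fun u _ => ⟨by rw [hzero]; exact hasDerivWithinAt_const _ _ _, hdom t ht⟩) ht rfl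
      refine hss (P.injOn_c (Ioc_subset_Icc_self hs) (Ioc_subset_Icc_self hs') ?_)
      rw [← h0, ← h1, hconst m0, hconst mτ]
    have hHy : ContinuousOn (P.H ∘ y) (Icc 0 τ) := (hP.continuousOn_H hr).comp hyc hyI
    have hsign : (∀ t ∈ Icc 0 τ, 0 < P.H (y t)) ∨ ∀ t ∈ Icc 0 τ, P.H (y t) < 0 := by
      by_contra! hcon
      obtain ⟨⟨t, ht, h⟩, ⟨u, hu, h'⟩⟩ := hcon
      obtain ⟨v, hv, hv0⟩ := isPreconnected_Icc.intermediate_value ht hu hHy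
        (⟨h, h'⟩ : (0 : ℝ) ∈ Icc _ _)
      exact hne v hv hv0
    rcases hsign with h | h
    · have hle := le_of_deriv_nonneg hτ hyd fun t ht => (h t ht).le
      rw [hy0, hyτ] at hle
      refine Or.inr (Or.inl ⟨lt_of_le_of_ne hle hss, fun u hu => ?_⟩)
      rw [← hy0, ← hyτ] at hu
      obtain ⟨t, ht, rfl⟩ := intermediate_value_Icc hτ hyc hu
      exact h t ht
    · have hle := le_of_deriv_nonneg hτ (fun t ht => (hyd t ht).neg)
        fun t ht => neg_nonneg.2 (h t ht).le
      simp only [Pi.neg_apply, neg_le_neg_iff, hy0, hyτ] at hle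
      refine Or.inr (Or.inr ⟨lt_of_le_of_ne hle (Ne.symm hss), fun u hu => ?_⟩)
      rw [← hy0, ← hyτ] at hu
      obtain ⟨t, ht, rfl⟩ := intermediate_value_Icc' hτ hyc hu
      exact h t ht
  · -- A solution of the scalar equation, composed with `c`, is a motion of the sliding field.
    have key : ∀ τ : ℝ, 0 ≤ τ → ∀ y : ℝ → ℝ, (∀ t ∈ Icc 0 τ,
        HasDerivWithinAt y (P.H (y t)) (Icc 0 τ) t ∧ y t ∈ Ioc P.a P.b) → y 0 = s → y τ = s' →
        P.c s' ∈ P.orbitSliding (P.c s) := by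
      rintro τ hτ y hy rfl rfl
      refine ⟨τ, hτ, P.c ∘ y, fun t ht => ⟨?_, hP.mem_curve_sliding.2 ⟨y t, (hy t ht).2, rfl⟩⟩,
        rfl, rfl⟩
      have hI := Ioc_subset_Icc_self (hy t ht).2
      have := (hasStrictDerivAt_c hI).hasDerivAt.scomp_hasDerivWithinAt t (hy t ht).1
      rwa [H_smul hI (hP.lie_ne hI)] at this
    rintro (rfl | ⟨hlt, h⟩ | ⟨hlt, h⟩)
    · exact mem_semiOrbit_self (hP.mem_curve_sliding.2 ⟨s, hs, rfl⟩)
    · have hsub : Icc s s' ⊆ Ioc P.a P.b := fun u hu => ⟨hs.1.trans_le hu.1, hu.2.trans hs'.2⟩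
      obtain ⟨τ, hτ, y, hy, h0, h1⟩ := exists_solution_of_pos hlt.le
        ((hP.continuousOn_H hr).mono (hsub.trans Ioc_subset_Icc_self)) h
      exact key τ hτ y (fun t ht => ⟨(hy t ht).1, hsub (hy t ht).2⟩) h0 h1
    · have hsub : Icc s' s ⊆ Ioc P.a P.b := fun u hu => ⟨hs'.1.trans_le hu.1, hu.2.trans hs.2⟩
      obtain ⟨τ, hτ, y, hy, h0, h1⟩ := exists_solution_of_neg hlt.le
        ((hP.continuousOn_H hr).mono (hsub.trans Ioc_subset_Icc_self)) h
      exact key τ hτ y (fun t ht => ⟨(hy t ht).1, hsub (hy t ht).2⟩) h0 h1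

end Arc

/-! ### Topological equivalence in terms of the direction function -/

theorem neg_iff_exists_moves {H : ℝ → ℝ} {a b s : ℝ} (hH : ContinuousOn H (Icc a b))
    (hs : s ∈ Ioc a b) : H s < 0 ↔ ∃ t ∈ Ioo a s, Moves H s t := by
  constructor
  · intro h
    have hev : ∀ᶠ u in 𝓝[≤] s, H u < 0 :=
      ((hH s (Ioc_subset_Icc_self hs)).mono_of_mem_nhdsWithin
        (Icc_mem_nhdsLE_of_mem hs)).eventually_lt_const h
    obtain ⟨t, ht, hsub⟩ := (mem_nhdsLE_iff_exists_mem_Ico_Ioc_subset hs.1).1 hev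
    refine ⟨(t + s) / 2, ⟨by linarith [ht.1, ht.2], by linarith [ht.2]⟩,
      Or.inr (Or.inr ⟨by linarith [ht.2], fun u hu => hsub ⟨by linarith [hu.1, ht.2], hu.2⟩⟩)⟩
  · rintro ⟨t, ht, rfl | ⟨h, -⟩ | ⟨-, h⟩⟩
    · exact absurd ht.2 (lt_irrefl _)
    · exact absurd ht.2 h.not_gt
    · exact h s (right_mem_Icc.2 ht.2.le)

theorem pos_iff_exists_moves {H : ℝ → ℝ} {a b s : ℝ} (hH : ContinuousOn H (Icc a b))
    (hs : s ∈ Ioc a b) : 0 < H s ↔ ∃ t ∈ Ioo a s, Moves H t s := by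
  constructor
  · intro h
    have hev : ∀ᶠ u in 𝓝[≤] s, 0 < H u :=
      ((hH s (Ioc_subset_Icc_self hs)).mono_of_mem_nhdsWithin
        (Icc_mem_nhdsLE_of_mem hs)).eventually_const_lt h
    obtain ⟨t, ht, hsub⟩ := (mem_nhdsLE_iff_exists_mem_Ico_Ioc_subset hs.1).1 hev
    refine ⟨(t + s) / 2, ⟨by linarith [ht.1, ht.2], by linarith [ht.2]⟩,
      Or.inr (Or.inl ⟨by linarith [ht.2], fun u hu => hsub ⟨by linarith [hu.1, ht.2], hu.2⟩⟩)⟩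
  · rintro ⟨t, ht, rfl | ⟨-, h⟩ | ⟨h, -⟩⟩
    · exact absurd ht.2 (lt_irrefl _)
    · exact h s (right_mem_Icc.2 ht.2.le)
    · exact absurd ht.2 h.not_gt

theorem sign_eq_sign_iff_lt {x y : ℝ} :
    SignType.sign x = SignType.sign y ↔ (x < 0 ↔ y < 0) ∧ (0 < x ↔ 0 < y) := by
  rcases lt_trichotomy x 0 with hx | rfl | hx <;> rcases lt_trichotomy y 0 with hy | rfl | hy <;>
    simp [*, le_of_lt] <;> constructor <;> intro _ <;> linarith

namespace Arc

variable {r : ℕ∞} {Z Z' : Field r} {P : Arc Z} {P' : Arc Z'}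

/-- The flows on the arcs `[A, B]` and `[A', B']` are conjugate up to a change of speed: an
increasing change of the coordinates matches the signs of the direction functions off `A`. -/
def SameSigns (P : Arc Z) (P' : Arc Z') : Prop :=
  ∃ e : Icc P.a P.b ≃o Icc P'.a P'.b,
    ∀ s : Icc P.a P.b, P.a < s → SignType.sign (P.H s) = SignType.sign (P'.H (e s))

/-- If all points of `(A, B]` are in the escaping or the sliding region, they are in the sliding
region, since `B` is. -/
theorem isSliding_of_mem_union (hr : 1 ≤ r)
    (h : ∀ s ∈ Ioc P.a P.b, P.c s ∈ Z.escaping ∪ Z.sliding) : P.IsSliding := by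
  intro s hs
  rcases h s hs with hesc | hsl
  · exfalso
    obtain ⟨u, hu, hu0⟩ := intermediate_value_Icc' hs.2
      ((continuousOn_lie₁_c (P := P) hr).mono (Icc_subset_Icc_left hs.1.le))
      (⟨lie_right_neg.le, hesc.2.1.le⟩ : (0 : ℝ) ∈ Icc _ _)
    rcases h u ⟨hs.1.trans_le hu.1, hu.2⟩ with h' | h'
    exacts [h'.2.1.ne' hu0, h'.2.1.ne hu0]
  · exact hsl

theorem mem_orbitSliding_self {x : ℝ × ℝ} :
    x ∈ P.orbitSliding x ↔ x ∈ P.curve ∩ (Z.escaping ∪ Z.sliding) :=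
  ⟨left_mem_of_mem_semiOrbit, mem_semiOrbit_self⟩

/-- The points of `Γ' ∩ Σ'` without sliding orbit reduce to `A'`, and `A` has none, so that an
equivalence maps `A` to `A'` and induces an increasing homeomorphism of the coordinates; the sign of
`H` at a point tells whether the point reaches, or is reached from, points closer to `A`. -/
theorem TopEquiv.isSliding_and_sameSigns (hr : 1 ≤ r) (hP' : P'.IsSliding)
    (h : P.TopEquiv P') : P.IsSliding ∧ P.SameSigns P' := by
  obtain ⟨h, hsw, -, -, hsl⟩ := h
  have hφ : ∀ s : Icc P.a P.b, ∃ u : Icc P'.a P'.b, P'.c u = h ⟨P.c s, c_mem_curve s.2⟩ := by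
    intro s
    obtain ⟨u, hu, hu'⟩ := mem_curve_switching.1
      ⟨(h ⟨P.c s, c_mem_curve s.2⟩).2, (hsw _).1 (P.c_mem s s.2)⟩
    exact ⟨⟨u, hu⟩, hu'⟩
  choose φ hφ using hφ
  have hcont : Continuous φ := by
    refine continuous_induced_rng.2 (continuousOn_univ.1 ?_)
    refine continuousOn_lift continuousOn_c P'.injOn_c (fun s _ => (φ s).2) ?_
    have : P'.c ∘ (Subtype.val ∘ φ) =
        fun s : Icc P.a P.b => (h ⟨P.c s, c_mem_curve s.2⟩ : ℝ × ℝ) := funext hφ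
    rw [this, continuousOn_univ]
    exact continuous_subtype_val.comp (h.continuous.comp
      ((continuousOn_iff_continuous_domRestrict.1 continuousOn_c).subtype_mk _))
  have hinj : Function.Injective φ := by
    intro s t hst
    have h1 := (hφ s).symm.trans ((congrArg (fun u : Icc P'.a P'.b => P'.c u) hst).trans (hφ t))
    exact Subtype.ext (P.injOn_c s.2 t.2 (congrArg Subtype.val (h.injective (Subtype.ext h1))))
  have hsurj : Function.Surjective φ := by
    intro u
    set x := h.symm ⟨P'.c u, c_mem_curve u.2⟩ with hx
    have hhx : h x = ⟨P'.c u, c_mem_curve u.2⟩ := h.apply_symm_apply _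
    have hxs : (x : ℝ × ℝ) ∈ Z.switching := by
      rw [hsw, hhx]
      exact P'.c_mem u u.2
    obtain ⟨s, hs, hsx⟩ := mem_curve_switching.1 ⟨x.2, hxs⟩
    refine ⟨⟨s, hs⟩, Subtype.ext (P'.injOn_c (φ _).2 u.2 ?_)⟩
    rw [hφ]
    have : (⟨P.c s, c_mem_curve hs⟩ : P.curve) = x := Subtype.ext hsx
    simp only [this, hhx]
  have hmem : ∀ s : Icc P.a P.b, P.c s ∈ Z.escaping ∪ Z.sliding ↔ P'.a < φ s := by
    intro s
    have h1 := hsl ⟨P.c s, c_mem_curve s.2⟩ ⟨P.c s, c_mem_curve s.2⟩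
    rw [mem_orbitSliding_self, mem_orbitSliding_self, ← hφ, hP'.mem_curve_sliding] at h1
    constructor
    · intro hs
      obtain ⟨u, hu, huφ⟩ := h1.1 ⟨c_mem_curve s.2, hs⟩
      rw [← P'.injOn_c (Ioc_subset_Icc_self hu) (φ s).2 huφ]
      exact hu.1
    · intro hs
      exact (h1.2 ⟨φ s, ⟨hs, (φ s).2.2⟩, rfl⟩).2
  have hleft : (φ ⟨P.a, P.left_mem⟩ : ℝ) = P'.a := by
    refine le_antisymm (not_lt.1 fun hlt => ?_) (φ _).2.1
    rcases (hmem ⟨P.a, P.left_mem⟩).2 hlt with h | h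
    exacts [h.2.1.ne' lie_left, h.2.1.ne lie_left]
  have hpos : ∀ s : Icc P.a P.b, P.a < s → P'.a < φ s := by
    intro s hs
    refine lt_of_le_of_ne (φ s).2.1 fun heq => hs.ne ?_
    have : φ ⟨P.a, P.left_mem⟩ = φ s := Subtype.ext (hleft.trans heq)
    exact congrArg Subtype.val (hinj this)
  have hP : P.IsSliding := isSliding_of_mem_union hr fun s hs =>
    (hmem ⟨s, Ioc_subset_Icc_self hs⟩).2 (hpos _ hs.1)
  have hmono : StrictMono φ := by
    have : Fact (P.a ≤ P.b) := ⟨P.a_lt_b.le⟩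
    refine hcont.strictMono_of_inj_boundedOrder ?_ hinj
    exact hleft.le.trans (φ ⊤).2.1
  have hmoves : ∀ s t : Icc P.a P.b, P.a < s → P.a < t →
      (Moves P.H s t ↔ Moves P'.H (φ s) (φ t)) := by
    intro s t hs ht
    rw [← hP.mem_orbitSliding hr ⟨hs, s.2.2⟩ ⟨ht, t.2.2⟩,
      ← hP'.mem_orbitSliding hr ⟨hpos s hs, (φ s).2.2⟩ ⟨hpos t ht, (φ t).2.2⟩, hφ, hφ]
    exact hsl ⟨P.c s, c_mem_curve s.2⟩ ⟨P.c t, c_mem_curve t.2⟩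
  -- Points strictly between `A` and `s` correspond to points strictly between `A'` and `φ s`.
  have htransfer : ∀ s : Icc P.a P.b, ∀ p : ℝ → Prop, ∀ p' : ℝ → Prop,
      (∀ t : Icc P.a P.b, P.a < t → (p t ↔ p' (φ t))) →
      ((∃ t ∈ Ioo P.a s, p t) ↔ ∃ t ∈ Ioo P'.a (φ s), p' t) := by
    intro s p p' hpp
    constructor
    · rintro ⟨t, ht, htp⟩
      have htI : t ∈ Icc P.a P.b := ⟨ht.1.le, ht.2.le.trans s.2.2⟩
      exact ⟨φ ⟨t, htI⟩, ⟨hpos _ ht.1, hmono (show (⟨t, htI⟩ : Icc P.a P.b) < s from ht.2)⟩,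
        (hpp ⟨t, htI⟩ ht.1).1 htp⟩
    · rintro ⟨u, hu, hup⟩
      obtain ⟨t, ht⟩ := hsurj ⟨u, hu.1.le, hu.2.le.trans (φ s).2.2⟩
      have htu : (φ t : ℝ) = u := congrArg Subtype.val ht
      have hlt : t < s := hmono.lt_iff_lt.1 (show (φ t : ℝ) < φ s by rw [htu]; exact hu.2)
      have hat : P.a < t := by
        refine lt_of_le_of_ne t.2.1 fun heq => hu.1.ne ?_
        rw [← htu]
        exact hleft.symm.trans (congrArg (fun x => (φ x : ℝ)) (Subtype.ext heq))
      exact ⟨t, ⟨hat, hlt⟩, (hpp t hat).2 (htu ▸ hup)⟩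
  refine ⟨hP, StrictMono.orderIsoOfSurjective φ hmono hsurj, fun s hs => ?_⟩
  rw [StrictMono.coe_orderIsoOfSurjective, sign_eq_sign_iff_lt,
    neg_iff_exists_moves (hP.continuousOn_H hr) ⟨hs, s.2.2⟩,
    neg_iff_exists_moves (hP'.continuousOn_H hr) ⟨hpos s hs, (φ s).2.2⟩,
    pos_iff_exists_moves (hP.continuousOn_H hr) ⟨hs, s.2.2⟩,
    pos_iff_exists_moves (hP'.continuousOn_H hr) ⟨hpos s hs, (φ s).2.2⟩]
  exact ⟨htransfer s _ _ fun t ht => hmoves s t hs ht, htransfer s _ _ fun t ht => hmoves t s ht hs⟩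

end Arc

/-! ### Construction of equivalences -/

/-- An increasing homeomorphism of compact intervals that matches two given interior points. -/
theorem exists_orderIso_Icc {a m b a' m' b' : ℝ} (h₁ : a < m) (h₂ : m < b) (h₁' : a' < m')
    (h₂' : m' < b') : ∃ e : Icc a b ≃o Icc a' b', ∀ s : Icc a b, (s : ℝ) = m → (e s : ℝ) = m' := by
  have k₁ : 0 < (m' - a') / (m - a) := div_pos (sub_pos.2 h₁') (sub_pos.2 h₁)
  have k₂ : 0 < (b' - m') / (b - m) := div_pos (sub_pos.2 h₂') (sub_pos.2 h₂)
  -- The piecewise affine map with the two slopes.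
  set g : ℝ → ℝ := fun s =>
    m' + (m' - a') / (m - a) * (min s m - m) + (b' - m') / (b - m) * (max s m - m) with hg
  have hgm : StrictMono g := by
    intro s t hst
    have h1 : min s m ≤ min t m := min_le_min_right m hst.le
    have h2 : max s m ≤ max t m := max_le_max_right m hst.le
    have h3 : min s m < min t m ∨ max s m < max t m := by
      rcases lt_or_ge s m with h | h
      · exact Or.inl (by rw [min_eq_left h.le]; exact lt_min hst h)
      · exact Or.inr (by rw [max_eq_left h]; exact lt_max_of_lt_left hst)
    simp only [hg]
    rcases h3 with h3 | h3 <;> nlinarith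
  have hga : g a = a' := by
    have : m - a ≠ 0 := (sub_pos.2 h₁).ne'
    simp only [hg, min_eq_left h₁.le, max_eq_right h₁.le]
    field_simp
    ring
  have hgb : g b = b' := by
    have : b - m ≠ 0 := (sub_pos.2 h₂).ne'
    simp only [hg, min_eq_right h₂.le, max_eq_left h₂.le]
    field_simp
    ring
  have hgM : g m = m' := by simp [hg]
  have hgc : Continuous g := by fun_prop
  have hmaps : MapsTo g (Icc a b) (Icc a' b') := fun s hs =>
    ⟨hga ▸ hgm.monotone hs.1, hgb ▸ hgm.monotone hs.2⟩
  have hsurj : Function.Surjective (hmaps.restrict g _ _) := by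
    rintro ⟨u, hu⟩
    rw [← hga, ← hgb] at hu
    obtain ⟨s, hs, hsu⟩ := intermediate_value_Icc (h₁.trans h₂).le hgc.continuousOn hu
    exact ⟨⟨s, hs⟩, Subtype.ext hsu⟩
  refine ⟨StrictMono.orderIsoOfSurjective (hmaps.restrict g _ _) (fun s t hst => hgm hst) hsurj, ?_⟩
  intro s hs
  change g s = m'
  rw [hs, hgM]

theorem orderIso_Icc_eq_left_iff {a b a' b' : ℝ} (hab : a ≤ b) (hab' : a' ≤ b')
    (e : Icc a b ≃o Icc a' b') (s : Icc a b) : (e s : ℝ) = a' ↔ (s : ℝ) = a := by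
  have : Fact (a ≤ b) := ⟨hab⟩
  have : Fact (a' ≤ b') := ⟨hab'⟩
  have h := map_eq_bot_iff e (a := s)
  rwa [← Subtype.coe_inj, ← Subtype.coe_inj] at h

theorem orderIso_Icc_eq_right_iff {a b a' b' : ℝ} (hab : a ≤ b) (hab' : a' ≤ b')
    (e : Icc a b ≃o Icc a' b') (s : Icc a b) : (e s : ℝ) = b' ↔ (s : ℝ) = b := by
  have : Fact (a ≤ b) := ⟨hab⟩
  have : Fact (a' ≤ b') := ⟨hab'⟩
  have h := map_eq_top_iff e (a := s)
  rwa [← Subtype.coe_inj, ← Subtype.coe_inj] at h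

/-- Homeomorphic spaces have homeomorphic quotients if the identifications correspond. -/
theorem exists_homeomorph_of_isQuotientMap {X X' Y Y' : Type*} [TopologicalSpace X]
    [TopologicalSpace X'] [TopologicalSpace Y] [TopologicalSpace Y'] {f : X → Y} {g : X' → Y'}
    (hf : IsQuotientMap f) (hg : IsQuotientMap g) (Φ : X ≃ₜ X')
    (h : ∀ x y, f x = f y ↔ g (Φ x) = g (Φ y)) : ∃ k : Y ≃ₜ Y', ∀ x, k (f x) = g (Φ x) := by
  have hbij : ∃ k : Y → Y', ∀ x, k (f x) = g (Φ x) := by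
    refine ⟨fun y => g (Φ (Function.surjInv hf.surjective y)), fun x => ?_⟩
    exact (h _ _).1 (Function.surjInv_eq hf.surjective (f x))
  have hbij' : ∃ k : Y' → Y, ∀ x, k (g (Φ x)) = f x := by
    refine ⟨fun y => f (Φ.symm (Function.surjInv hg.surjective y)), fun x => ?_⟩
    rw [h, Φ.apply_symm_apply]
    exact Function.surjInv_eq hg.surjective _
  obtain ⟨k, hk⟩ := hbij
  obtain ⟨k', hk'⟩ := hbij'
  refine ⟨⟨⟨k, k', fun y => ?_, fun y => ?_⟩, ?_, ?_⟩, hk⟩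
  · obtain ⟨x, rfl⟩ := hf.surjective y
    rw [hk, hk']
  · obtain ⟨x, rfl⟩ := hg.surjective y
    obtain ⟨x, rfl⟩ := Φ.surjective x
    rw [hk', hk]
  · refine hf.continuous_iff.2 ?_
    have : k ∘ f = g ∘ Φ := funext hk
    exact this ▸ hg.continuous.comp Φ.continuous
  · refine hg.continuous_iff.2 ?_
    have : k' ∘ g = f ∘ Φ.symm := funext fun x => by
      obtain ⟨x, rfl⟩ := Φ.surjective x
      simp [hk']
    exact this ▸ hf.continuous.comp Φ.symm.continuous

namespace Arc

variable {r : ℕ∞} {Z Z' : Field r} {P : Arc Z} {P' : Arc Z'}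

/-- The parametrization of `Γ` by the disjoint union of the time interval of `γ` and the coordinate
interval of `[A, B]`. -/
def param (P : Arc Z) : Icc 0 P.T ⊕ Icc P.a P.b → P.curve :=
  Sum.elim (fun t => ⟨P.γ t, gamma_mem_curve t.2⟩) fun s => ⟨P.c s, c_mem_curve s.2⟩

theorem isQuotientMap_param : IsQuotientMap P.param := by
  have hcont : Continuous P.param :=
    ((continuousOn_iff_continuous_domRestrict.1 continuousOn_gamma).subtype_mk _).sumElim
      ((continuousOn_iff_continuous_domRestrict.1 continuousOn_c).subtype_mk _)
  refine hcont.isClosedMap.isQuotientMap hcont ?_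
  rintro ⟨_, ⟨t, ht, rfl⟩ | ⟨s, hs, rfl⟩⟩
  exacts [⟨Sum.inl ⟨t, ht⟩, rfl⟩, ⟨Sum.inr ⟨s, hs⟩, rfl⟩]

/-- Increasing changes of the two parameters induce a homeomorphism of the closed curves. -/
theorem exists_homeomorph_curve (hr : 1 ≤ r) (ρ : Icc 0 P.T ≃o Icc 0 P'.T)
    (e : Icc P.a P.b ≃o Icc P'.a P'.b) :
    ∃ h : P.curve ≃ₜ P'.curve,
      (∀ (t : Icc 0 P.T) (x : P.curve), P'.γ (ρ t) = h x ↔ P.γ t = x) ∧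
        ∀ (s : Icc P.a P.b) (x : P.curve), P'.c (e s) = h x ↔ P.c s = x := by
  have hmix : ∀ (t : Icc 0 P.T) (s : Icc P.a P.b),
      P.γ t = P.c s ↔ P'.γ (ρ t) = P'.c (e s) := by
    intro t s
    rw [gamma_eq_c_iff t.2 s.2, gamma_eq_c_iff (ρ t).2 (e s).2,
      orderIso_Icc_eq_left_iff P.T_pos.le P'.T_pos.le, orderIso_Icc_eq_right_iff P.T_pos.le
      P'.T_pos.le, orderIso_Icc_eq_left_iff P.a_lt_b.le P'.a_lt_b.le,
      orderIso_Icc_eq_right_iff P.a_lt_b.le P'.a_lt_b.le]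
  obtain ⟨h, hh⟩ := exists_homeomorph_of_isQuotientMap (isQuotientMap_param (P := P))
    (isQuotientMap_param (P := P')) (ρ.toHomeomorph.sumCongr e.toHomeomorph) (by
      rintro (t | s) (t' | s') <;> refine Subtype.mk_eq_mk.trans (Iff.trans ?_ Subtype.mk_eq_mk.symm)
      · change P.γ t = P.γ t' ↔ P'.γ (ρ t) = P'.γ (ρ t')
        rw [(gamma_injOn hr).eq_iff t.2 t'.2, (gamma_injOn hr).eq_iff (ρ t).2 (ρ t').2,
          Subtype.coe_inj, Subtype.coe_inj, ρ.injective.eq_iff]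
      · exact hmix t s'
      · exact eq_comm.trans ((hmix t' s).trans eq_comm)
      · change P.c s = P.c s' ↔ P'.c (e s) = P'.c (e s')
        rw [P.injOn_c.eq_iff s.2 s'.2, P'.injOn_c.eq_iff (e s).2 (e s').2,
          Subtype.coe_inj, Subtype.coe_inj, e.injective.eq_iff])
  refine ⟨h, fun t x => ?_, fun s x => ?_⟩
  · have h1 : (h (P.param (Sum.inl t)) : ℝ × ℝ) = P'.γ (ρ t) := by rw [hh]; rfl
    rw [← h1, Subtype.coe_inj, h.injective.eq_iff, ← Subtype.coe_inj]
    rfl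
  · have h1 : (h (P.param (Sum.inr s)) : ℝ × ℝ) = P'.c (e s) := by rw [hh]; rfl
    rw [← h1, Subtype.coe_inj, h.injective.eq_iff, ← Subtype.coe_inj]
    rfl

theorem mem_switching_iff (x : P.curve) :
    (x : ℝ × ℝ) ∈ Z.switching ↔ ∃ s : Icc P.a P.b, P.c s = x := by
  have := mem_curve_switching (P := P) (x := x)
  simpa using this

theorem IsSliding.mem_orbit₁ (hr : 1 ≤ r) (hP : P.IsSliding) (x y : P.curve) :
    (y : ℝ × ℝ) ∈ P.orbit₁ x ↔ y = x ∨ ∃ t u : Icc 0 P.T, t ≤ u ∧ P.γ t = x ∧ P.γ u = y := by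
  constructor
  · intro h
    obtain ⟨x, ⟨t, ht, rfl⟩ | ⟨s, hs, rfl⟩⟩ := x
    · obtain ⟨u, hu, huy⟩ := (mem_orbit₁_gamma hr ht).1 h
      exact Or.inr ⟨⟨t, ht⟩, ⟨u, ht.1.trans hu.1, hu.2⟩, hu.1, rfl, huy⟩
    rcases eq_or_lt_of_le hs.1 with rfl | has
    · have h0 : (0 : ℝ) ∈ Icc 0 P.T := left_mem_Icc.2 P.T_pos.le
      simp only [← P.γ_start] at h ⊢
      obtain ⟨u, hu, huy⟩ := (mem_orbit₁_gamma hr h0).1 h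
      exact Or.inr ⟨⟨0, h0⟩, ⟨u, hu⟩, hu.1, rfl, huy⟩
    · exact Or.inl (Subtype.ext ((hP.mem_orbit₁_c ⟨has, hs.2⟩).1 h))
  · rintro (rfl | ⟨t, u, htu, ht, hu⟩)
    · exact mem_semiOrbit_self ⟨y.2, curve_subset_upper y.2⟩
    · rw [← ht]
      exact (mem_orbit₁_gamma hr t.2).2 ⟨u, ⟨htu, u.2.2⟩, hu⟩

theorem IsSliding.mem_orbitSliding_iff (hr : 1 ≤ r) (hP : P.IsSliding) (x y : P.curve) :
    (y : ℝ × ℝ) ∈ P.orbitSliding x ↔ ∃ s t : Icc P.a P.b, (P.a < s ∧ P.a < t ∧ Moves P.H s t) ∧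
      P.c s = x ∧ P.c t = y := by
  constructor
  · intro h
    obtain ⟨s, hs, hsx⟩ := hP.mem_curve_sliding.1 (left_mem_of_mem_semiOrbit h)
    obtain ⟨t, ht, hty⟩ := hP.mem_curve_sliding.1 (right_mem_of_mem_semiOrbit h)
    rw [← hsx, ← hty, hP.mem_orbitSliding hr hs ht] at h
    exact ⟨⟨s, Ioc_subset_Icc_self hs⟩, ⟨t, Ioc_subset_Icc_self ht⟩, ⟨hs.1, ht.1, h⟩, hsx, hty⟩
  · rintro ⟨s, t, ⟨hs, ht, h⟩, hsx, hty⟩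
    rw [← hsx, ← hty, hP.mem_orbitSliding hr ⟨hs, s.2.2⟩ ⟨ht, t.2.2⟩]
    exact h

theorem moves_iff_of_sign_eq (e : Icc P.a P.b ≃o Icc P'.a P'.b)
    (he : ∀ s : Icc P.a P.b, P.a < s → SignType.sign (P.H s) = SignType.sign (P'.H (e s)))
    {s t : Icc P.a P.b} (hs : P.a < s) (ht : P.a < t) :
    Moves P.H s t ↔ Moves P'.H (e s) (e t) := by
  have hint : ∀ (p p' : ℝ → Prop) (s t : Icc P.a P.b), P.a < s →
      (∀ u : Icc P.a P.b, P.a < u → (p (P.H u) ↔ p' (P'.H (e u)))) →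
      ((∀ u ∈ Icc (s : ℝ) t, p (P.H u)) ↔ ∀ u ∈ Icc (e s : ℝ) (e t), p' (P'.H u)) := by
    intro p p' s t hs hp
    constructor
    · intro h u hu
      obtain ⟨v, hv⟩ := e.surjective ⟨u, (e s).2.1.trans hu.1, hu.2.trans (e t).2.2⟩
      have hvu : (e v : ℝ) = u := congrArg Subtype.val hv
      rw [← hvu] at hu ⊢
      have h1 : s ≤ v := e.le_iff_le.1 hu.1
      have h2 : v ≤ t := e.le_iff_le.1 hu.2
      exact (hp v (hs.trans_le h1)).1 (h v ⟨h1, h2⟩)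
    · intro h u hu
      have huI : u ∈ Icc P.a P.b := ⟨s.2.1.trans hu.1, hu.2.trans t.2.2⟩
      refine (hp ⟨u, huI⟩ (hs.trans_le hu.1)).2 (h _ ⟨?_, ?_⟩)
      · exact e.le_iff_le.2 (show s ≤ ⟨u, huI⟩ from hu.1)
      · exact e.le_iff_le.2 (show ⟨u, huI⟩ ≤ t from hu.2)
  have hlt : ∀ s t : Icc P.a P.b, (s : ℝ) < t ↔ (e s : ℝ) < e t := fun s t =>
    (e.lt_iff_lt (x := s) (y := t)).symm
  have hpos := hint (fun x => 0 < x) (fun x => 0 < x) s t hs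
    fun u hu => (sign_eq_sign_iff_lt.1 (he u hu)).2
  have hneg := hint (fun x => x < 0) (fun x => x < 0) t s ht
    fun u hu => (sign_eq_sign_iff_lt.1 (he u hu)).1
  rw [Moves, Moves, hpos, hneg, hlt s t, hlt t s, Subtype.coe_inj, Subtype.coe_inj,
    e.injective.eq_iff]

/-- If both arcs slide, matching signs of the direction functions suffice for an equivalence. -/
theorem SameSigns.topEquiv (hr : 1 ≤ r) (hP : P.IsSliding) (hP' : P'.IsSliding)
    (h : P.SameSigns P') : P.TopEquiv P' := by
  obtain ⟨e, he⟩ := h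
  obtain ⟨ρ, -⟩ := exists_orderIso_Icc (half_pos P.T_pos) (half_lt_self P.T_pos)
    (half_pos P'.T_pos) (half_lt_self P'.T_pos)
  obtain ⟨h, hγ, hc⟩ := exists_homeomorph_curve hr ρ e
  have hsw : ∀ x : P.curve, (x : ℝ × ℝ) ∈ Z.switching ↔ (h x : ℝ × ℝ) ∈ Z'.switching := by
    intro x
    rw [mem_switching_iff, mem_switching_iff, e.surjective.exists]
    simp only [hc]
  have hleft : ∀ s : Icc P.a P.b, P.a < s ↔ P'.a < e s := by
    intro s
    rw [(s.2.1).lt_iff_ne', ((e s).2.1).lt_iff_ne', Ne, Ne,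
      orderIso_Icc_eq_left_iff P.a_lt_b.le P'.a_lt_b.le]
  refine ⟨h, hsw, fun x y => ?_, fun x y => ?_, fun x y => ?_⟩
  · rw [hP.mem_orbit₁ hr, hP'.mem_orbit₁ hr, ρ.surjective.exists₂, h.injective.eq_iff]
    simp only [hγ, ρ.le_iff_le]
  · rw [hP.mem_orbit₂ hr, hP'.mem_orbit₂ hr, Subtype.coe_inj, Subtype.coe_inj, h.injective.eq_iff]
    have h1 := mem_switching_iff x
    have h2 := mem_switching_iff (h x)
    simp only [Subtype.exists, exists_prop] at h1 h2
    rw [← h1, ← h2, hsw]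
  · rw [hP.mem_orbitSliding_iff hr, hP'.mem_orbitSliding_iff hr, e.surjective.exists₂]
    refine exists_congr fun s => exists_congr fun t => and_congr ?_ (by simp only [hc])
    constructor
    · rintro ⟨hs, ht, hm⟩
      exact ⟨(hleft s).1 hs, (hleft t).1 ht, (moves_iff_of_sign_eq e he hs ht).1 hm⟩
    · rintro ⟨hs, ht, hm⟩
      rw [← hleft] at hs ht
      exact ⟨hs, ht, (moves_iff_of_sign_eq e he hs ht).2 hm⟩

end Arc

/-! ### Zeros and signs of the direction function -/

theorem sign_eq_of_ne_zero {H : ℝ → ℝ} {u v : ℝ} (huv : u ≤ v) (hc : ContinuousOn H (Icc u v))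
    (h0 : ∀ w ∈ Icc u v, H w ≠ 0) : SignType.sign (H u) = SignType.sign (H v) := by
  rcases (h0 u (left_mem_Icc.2 huv)).lt_or_gt with hu | hu <;>
    rcases (h0 v (right_mem_Icc.2 huv)).lt_or_gt with hv | hv
  · rw [sign_neg hu, sign_neg hv]
  · obtain ⟨w, hw, hw0⟩ := intermediate_value_Icc huv hc ⟨hu.le, hv.le⟩
    exact absurd hw0 (h0 w hw)
  · obtain ⟨w, hw, hw0⟩ := intermediate_value_Icc' huv hc ⟨hv.le, hu.le⟩
    exact absurd hw0 (h0 w hw)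
  · rw [sign_pos hu, sign_pos hv]

namespace Arc

variable {r : ℕ∞} {Z Z' : Field r} {P : Arc Z} {P' : Arc Z'}

theorem SameSigns.sign_right (h : P.SameSigns P') :
    SignType.sign (P.H P.b) = SignType.sign (P'.H P'.b) := by
  obtain ⟨e, he⟩ := h
  have h1 := he ⟨P.b, P.right_mem⟩ P.a_lt_b
  have h2 : (e ⟨P.b, P.right_mem⟩ : ℝ) = P'.b :=
    (orderIso_Icc_eq_right_iff P.a_lt_b.le P'.a_lt_b.le e _).2 rfl
  rwa [h2] at h1

/-- Under `SameSigns` the interior zeros correspond. -/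
theorem SameSigns.exists_zero_iff (h : P.SameSigns P') :
    ∃ e : Icc P.a P.b ≃o Icc P'.a P'.b, ∀ s : Icc P.a P.b,
      ((s : ℝ) ∈ Ioo P.a P.b ∧ P.H s = 0) ↔ ((e s : ℝ) ∈ Ioo P'.a P'.b ∧ P'.H (e s) = 0) := by
  obtain ⟨e, he⟩ := h
  refine ⟨e, fun s => ?_⟩
  have hl : P.a < s ↔ P'.a < e s := by
    rw [s.2.1.lt_iff_ne', (e s).2.1.lt_iff_ne', Ne, Ne,
      orderIso_Icc_eq_left_iff P.a_lt_b.le P'.a_lt_b.le]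
  have hr : s < P.b ↔ e s < P'.b := by
    rw [s.2.2.lt_iff_ne, (e s).2.2.lt_iff_ne, Ne, Ne,
      orderIso_Icc_eq_right_iff P.a_lt_b.le P'.a_lt_b.le]
  rw [mem_Ioo, mem_Ioo, ← hl, ← hr]
  refine and_congr_right fun hs => ?_
  rw [← sign_eq_zero_iff, he s hs.1, sign_eq_zero_iff]

theorem SameSigns.existsUnique_zero (h : P.SameSigns P')
    (h' : ∃! s : ℝ, s ∈ Ioo P'.a P'.b ∧ P'.H s = 0) :
    ∃! s : ℝ, s ∈ Ioo P.a P.b ∧ P.H s = 0 := by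
  obtain ⟨e, he⟩ := h.exists_zero_iff
  obtain ⟨u, hu, huniq⟩ := h'
  obtain ⟨s, hs⟩ := e.surjective ⟨u, Ioo_subset_Icc_self hu.1⟩
  refine ⟨s, (he s).2 (by rw [hs]; exact hu), fun t ht => ?_⟩
  have h1 := huniq _ ((he ⟨t, Ioo_subset_Icc_self ht.1⟩).1 ht)
  have h2 : e ⟨t, Ioo_subset_Icc_self ht.1⟩ = e s := by
    rw [hs]
    exact Subtype.ext h1
  exact congrArg Subtype.val (e.injective h2)

theorem SameSigns.ne_zero (h : P.SameSigns P') (h' : ∀ s ∈ Ioo P'.a P'.b, P'.H s ≠ 0) :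
    ∀ s ∈ Ioo P.a P.b, P.H s ≠ 0 := by
  obtain ⟨e, he⟩ := h.exists_zero_iff
  intro s hs h0
  have := (he ⟨s, Ioo_subset_Icc_self hs⟩).1 ⟨hs, h0⟩
  exact h' _ this.1 this.2

/-- Before its first zero, `H` has the sign that it has at the fold. -/
theorem IsSliding.sign_H_of_lt (hr : 1 ≤ r) (hP : P.IsSliding) {s : ℝ} (hs : s ∈ Icc P.a P.b)
    (h0 : ∀ u ∈ Ioc P.a s, P.H u ≠ 0) : SignType.sign (P.H s) = -1 := by
  rw [← sign_neg (hP.H_left_neg hr)]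
  refine (sign_eq_of_ne_zero hs.1 ((hP.continuousOn_H hr).mono (Icc_subset_Icc_right hs.2))
    fun u hu => ?_).symm
  rcases eq_or_lt_of_le hu.1 with rfl | h
  exacts [(hP.H_left_neg hr).ne, h0 u ⟨h, hu.2⟩]

theorem sameSigns_of_existsUnique_zero (hr : 1 ≤ r) (hP : P.IsSliding) (hP' : P'.IsSliding)
    (h : ∃! s : ℝ, s ∈ Ioo P.a P.b ∧ P.H s = 0) (h' : ∃! s : ℝ, s ∈ Ioo P'.a P'.b ∧ P'.H s = 0)
    (hb : P.H P.b ≠ 0) (hsign : SignType.sign (P.H P.b) = SignType.sign (P'.H P'.b)) :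
    P.SameSigns P' := by
  -- The sign of `H` is `-1` before the zero, and that of `H(B)` behind it.
  have key : ∀ {Z : Field r} {P : Arc Z}, P.IsSliding → P.H P.b ≠ 0 →
      ∀ m, m ∈ Ioo P.a P.b → (∀ s, s ∈ Ioo P.a P.b ∧ P.H s = 0 → s = m) →
      ∀ s ∈ Icc P.a P.b, (s < m → SignType.sign (P.H s) = -1) ∧
        (m < s → SignType.sign (P.H s) = SignType.sign (P.H P.b)) := by
    intro Z P hP hb m hm huniq s hs
    constructor
    · intro hsm
      refine hP.sign_H_of_lt hr hs fun u hu h0 => ?_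
      have := huniq u ⟨⟨hu.1, hu.2.trans_lt (hsm.trans hm.2)⟩, h0⟩
      linarith [hu.2]
    · intro hsm
      refine sign_eq_of_ne_zero hs.2 ((hP.continuousOn_H hr).mono (Icc_subset_Icc_left hs.1))
        fun u hu h0 => ?_
      rcases eq_or_lt_of_le hu.2 with rfl | hub
      · exact hb h0
      · have := huniq u ⟨⟨hm.1.trans (hsm.trans_le hu.1), hub⟩, h0⟩
        linarith [hu.1]
  obtain ⟨m, ⟨hm, hm0⟩, huniq⟩ := h
  obtain ⟨m', ⟨hm', hm0'⟩, huniq'⟩ := h'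
  have hb' : P'.H P'.b ≠ 0 := by
    rw [← sign_ne_zero, ← hsign, sign_ne_zero]
    exact hb
  obtain ⟨e, he⟩ := exists_orderIso_Icc hm.1 hm.2 hm'.1 hm'.2
  have hem : e ⟨m, Ioo_subset_Icc_self hm⟩ = ⟨m', Ioo_subset_Icc_self hm'⟩ :=
    Subtype.ext (he _ rfl)
  refine ⟨e, fun s _ => ?_⟩
  have k := key hP hb m hm huniq s s.2
  have k' := key hP' hb' m' hm' huniq' (e s) (e s).2
  rcases lt_trichotomy (s : ℝ) m with hs | hs | hs
  · have : e s < e ⟨m, Ioo_subset_Icc_self hm⟩ := e.lt_iff_lt.2 hs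
    rw [hem] at this
    rw [k.1 hs, k'.1 this]
  · rw [he s hs, hs, hm0, hm0']
  · have : e ⟨m, Ioo_subset_Icc_self hm⟩ < e s := e.lt_iff_lt.2 hs
    rw [hem] at this
    rw [k.2 hs, k'.2 this, hsign]

theorem sameSigns_of_ne_zero (hr : 1 ≤ r) (hP : P.IsSliding) (hP' : P'.IsSliding)
    (h : ∀ s ∈ Ioo P.a P.b, P.H s ≠ 0) (h' : ∀ s ∈ Ioo P'.a P'.b, P'.H s ≠ 0)
    (hb : P.H P.b = 0) (hb' : P'.H P'.b = 0) : P.SameSigns P' := by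
  have hP_lt := P.a_lt_b
  have hP'_lt := P'.a_lt_b
  obtain ⟨e, -⟩ := exists_orderIso_Icc (left_lt_add_div_two.2 hP_lt) (add_div_two_lt_right.2 hP_lt)
    (left_lt_add_div_two.2 hP'_lt) (add_div_two_lt_right.2 hP'_lt)
  refine ⟨e, fun s _ => ?_⟩
  have hright := orderIso_Icc_eq_right_iff hP_lt.le hP'_lt.le e s
  rcases eq_or_lt_of_le s.2.2 with hs | hs
  · rw [hright.2 hs, hs, hb, hb']
  · have hs' : e s < P'.b := lt_of_le_of_ne (e s).2.2 fun heq => hs.ne (hright.1 heq)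
    rw [hP.sign_H_of_lt hr s.2 fun u hu => h u ⟨hu.1, hu.2.trans_lt hs⟩,
      hP'.sign_H_of_lt hr (e s).2 fun u hu => h' u ⟨hu.1, hu.2.trans_lt hs'⟩]

end Arc

/-! ### The model systems -/

section model

variable {r : ℕ∞} {g : ℝ → ℝ} {hg : ContDiff ℝ r g} {k : ℝ}

theorem lie_snd (X : ℝ × ℝ → ℝ × ℝ) (q : ℝ × ℝ) : lie X Prod.snd q = (X q).2 := by
  have h : fderiv ℝ (Prod.snd : ℝ × ℝ → ℝ) q = ContinuousLinearMap.snd ℝ ℝ ℝ := fderiv_snd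
  rw [lie, h]
  rfl

theorem lie_modelField₁ (q : ℝ × ℝ) :
    lie (modelField r g hg k).X₁ (modelField r g hg k).f q = -q.1 + q.2 - 1 := lie_snd _ q

theorem lie_modelField₂ (q : ℝ × ℝ) :
    lie (modelField r g hg k).X₂ (modelField r g hg k).f q = k := lie_snd _ q

theorem lie_lie_modelField₁ (q : ℝ × ℝ) :
    lie (modelField r g hg k).X₁ (lie (modelField r g hg k).X₁ (modelField r g hg k).f) q
      = -2 * q.1 := by
  have h1 : lie (modelField r g hg k).X₁ (modelField r g hg k).f
      = fun q : ℝ × ℝ => -q.1 + q.2 - 1 := funext lie_modelField₁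
  have h2 : HasFDerivAt (fun q : ℝ × ℝ => -q.1 + q.2 - 1)
      (-ContinuousLinearMap.fst ℝ ℝ ℝ + ContinuousLinearMap.snd ℝ ℝ ℝ) q :=
    (hasFDerivAt_fst.neg.add hasFDerivAt_snd).sub_const 1
  rw [h1, lie, h2.fderiv]
  simp [modelField]
  ring

theorem slidingField_modelField_fst (x : ℝ) :
    ((modelField r g hg k).slidingField (x, 0)).1
      = (k + x + 1)⁻¹ * (k * (x - 1) + (x + 1) * g x) := by
  rw [Field.slidingField, lie_modelField₁, lie_modelField₂]
  simp only [modelField, Prod.smul_fst, Prod.fst_sub, smul_eq_mul]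
  ring

namespace Arc

variable (P : Arc (modelField r g hg k))

theorem model_c_snd {s : ℝ} (hs : s ∈ Icc P.a P.b) : (P.c s).2 = 0 := f_c hs

theorem model_left : (P.c P.a).1 = -1 := by
  have h := lie_left (P := P)
  rw [lie_modelField₁, model_c_snd P P.left_mem] at h
  linarith

theorem model_right_gt_neg_one : -1 < (P.c P.b).1 := by
  have h := lie_right_neg (P := P)
  rw [lie_modelField₁, model_c_snd P P.right_mem] at h
  linarith

theorem model_continuousOn_fst : ContinuousOn (fun s => (P.c s).1) (Icc P.a P.b) :=
  continuousOn_c.fst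

theorem model_strictMonoOn : StrictMonoOn (fun s => (P.c s).1) (Icc P.a P.b) := by
  refine (model_continuousOn_fst P).strictMonoOn_of_injOn_Icc P.a_lt_b.le ?_ fun s hs t ht hst => ?_
  · change (P.c P.a).1 ≤ (P.c P.b).1
    rw [model_left]
    exact (model_right_gt_neg_one P).le
  · refine P.injOn_c hs ht (Prod.ext hst ?_)
    rw [model_c_snd P hs, model_c_snd P ht]

/-- The squared distance to the focus `(0, 1)` of the model field `X₁` grows along `γ`; as `A` and
`B` are on the `x`-axis, `B` is farther from the origin than `A`. -/
theorem model_one_lt_right : 1 < (P.c P.b).1 := by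
  have hd : ∀ t ∈ Icc 0 P.T, HasDerivWithinAt (fun t => (P.γ t).1 ^ 2 + ((P.γ t).2 - 1) ^ 2)
      (2 * ((P.γ t).1 ^ 2 + ((P.γ t).2 - 1) ^ 2)) (Icc 0 P.T) t := by
    intro t ht
    have h := P.solution_γ t ht
    have h1 : HasDerivWithinAt (fun t => (P.γ t).1) ((P.γ t).1 + (P.γ t).2 - 1) (Icc 0 P.T) t :=
      h.fst
    have h2 : HasDerivWithinAt (fun t => (P.γ t).2) (-(P.γ t).1 + (P.γ t).2 - 1) (Icc 0 P.T) t :=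
      h.snd
    refine ((h1.pow 2).add ((h2.sub_const 1).pow 2)).congr_deriv ?_
    push_cast
    ring
  -- The growth is exponential, which makes it strict.
  have hd' : ∀ t ∈ Icc 0 P.T, HasDerivWithinAt (fun t => Real.exp (-(2 * t))
      * ((P.γ t).1 ^ 2 + ((P.γ t).2 - 1) ^ 2)) 0 (Icc 0 P.T) t := by
    intro t ht
    have h := (((hasDerivAt_id t).const_mul 2).neg.exp.hasDerivWithinAt (s := Icc 0 P.T)).mul
      (hd t ht)
    refine h.congr_deriv ?_
    simp only [id, Pi.neg_apply]
    ring
  have h1 := le_of_deriv_nonneg P.T_pos.le hd' fun t _ => le_rfl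
  simp only [P.γ_start, P.γ_end, model_left, model_c_snd P P.left_mem,
    model_c_snd P P.right_mem] at h1
  have hexp : Real.exp (-(2 * P.T)) < 1 := Real.exp_lt_one_iff.2 (by linarith [P.T_pos])
  have h0 := model_right_gt_neg_one P
  norm_num at h1
  have hpos : 0 < (P.c P.b).1 ^ 2 + 1 := by positivity
  have h3 : 2 < (P.c P.b).1 ^ 2 + 1 := by nlinarith [Real.exp_pos (-(2 * P.T))]
  nlinarith

variable {P}

theorem model_isSliding (hk : 0 < k) : P.IsSliding := by
  intro s hs
  have hI := Ioc_subset_Icc_self hs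
  refine ⟨P.c_mem s hI, ?_, by rwa [lie_modelField₂]⟩
  have h := model_strictMonoOn P P.left_mem hI hs.1
  simp only [model_left] at h
  rw [lie_modelField₁, model_c_snd P hI]
  linarith

/-- The sign of the direction function of a model is that of the numerator of the first component
of the sliding field. -/
theorem model_sign_H (hk : 0 < k) {s : ℝ} (hs : s ∈ Icc P.a P.b) :
    SignType.sign (P.H s)
      = SignType.sign (k * ((P.c s).1 - 1) + ((P.c s).1 + 1) * g (P.c s).1) := by
  have hH := congrArg Prod.fst (H_smul hs ((model_isSliding hk).lie_ne hs))
  have hcs : P.c s = ((P.c s).1, 0) := Prod.ext rfl (model_c_snd P hs)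
  have hx : -1 ≤ (P.c s).1 := by
    have := (model_strictMonoOn P).monotoneOn P.left_mem hs hs.1
    simpa only [model_left] using this
  have hd2 : (deriv P.c s).2 = 0 := by
    have := fderiv_f_deriv_c hs
    have h' := lie_snd (fun _ => deriv P.c s) (P.c s)
    exact h'.symm.trans this
  have hd1 : 0 < (deriv P.c s).1 := by
    have h1 : HasDerivWithinAt (fun s => (P.c s).1) (deriv P.c s).1 (Icc P.a P.b) s :=
      (hasStrictDerivAt_c hs).hasDerivAt.hasDerivWithinAt.fst
    have h2 : 0 ≤ derivWithin (fun s => (P.c s).1) (Icc P.a P.b) s :=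
      (model_strictMonoOn P).monotoneOn.derivWithin_nonneg
    rw [h1.derivWithin (uniqueDiffOn_Icc P.a_lt_b s hs)] at h2
    refine lt_of_le_of_ne h2 fun h0 => P.regular_c s hs (Prod.ext h0.symm hd2)
  have hden : 0 < (k + (P.c s).1 + 1)⁻¹ := inv_pos.2 (by linarith)
  have h3 : P.H s * (deriv P.c s).1 = (k + (P.c s).1 + 1)⁻¹
      * (k * ((P.c s).1 - 1) + ((P.c s).1 + 1) * g (P.c s).1) := by
    rw [← slidingField_modelField_fst (r := r) (hg := hg), ← hcs, ← hH]
    rfl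
  have h4 := congrArg SignType.sign h3
  rwa [sign_mul, sign_mul, sign_pos hd1, sign_pos hden, mul_one, one_mul] at h4

theorem model_existsUnique_zero
    (h : ∀ s ∈ Icc P.a P.b, P.a < s → (P.H s = 0 ↔ (P.c s).1 = 1)) :
    ∃! s : ℝ, s ∈ Ioo P.a P.b ∧ P.H s = 0 := by
  have h1 := model_one_lt_right P
  obtain ⟨s, hs, hs1⟩ := intermediate_value_Ioo P.a_lt_b.le (model_continuousOn_fst P)
    (⟨by rw [model_left]; norm_num, h1⟩ : (1 : ℝ) ∈ Ioo (P.c P.a).1 (P.c P.b).1)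
  refine ⟨s, ⟨hs, (h s (Ioo_subset_Icc_self hs) hs.1).2 hs1⟩, fun t ht => ?_⟩
  have ht1 := (h t (Ioo_subset_Icc_self ht.1) ht.1.1).1 ht.2
  exact (model_strictMonoOn P).injOn (Ioo_subset_Icc_self ht.1) (Ioo_subset_Icc_self hs)
    (ht1.trans hs1.symm)

theorem model_neg_one_lt {s : ℝ} (hs : s ∈ Icc P.a P.b) (h : P.a < s) : -1 < (P.c s).1 := by
  have := model_strictMonoOn P P.left_mem hs h
  simpa only [model_left] using this

end Arc
end model

namespace Arc

variable {r : ℕ∞}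

theorem modelOne_isSliding (P : Arc (modelOne r)) : P.IsSliding := model_isSliding one_pos

theorem modelOne_sign_H (P : Arc (modelOne r)) {s : ℝ} (hs : s ∈ Icc P.a P.b) :
    SignType.sign (P.H s)
      = SignType.sign (-(((P.c s).1 - 1) ^ 2 * ((P.c s).1 + 3 / 2))) := by
  refine (model_sign_H one_pos hs).trans (congrArg SignType.sign ?_)
  ring

theorem modelOne_existsUnique_zero (P : Arc (modelOne r)) :
    ∃! s : ℝ, s ∈ Ioo P.a P.b ∧ P.H s = 0 := by
  refine model_existsUnique_zero fun s hs has => ?_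
  have hx : (P.c s).1 + 3 / 2 ≠ 0 := by linarith [model_neg_one_lt hs has]
  have h : P.H s = 0 ↔ (P.c s).1 = 1 := by
    rw [← sign_eq_zero_iff, modelOne_sign_H P hs, sign_eq_zero_iff]
    simp [hx, sub_eq_zero]
  exact h

theorem modelOne_H_right (P : Arc (modelOne r)) : P.H P.b < 0 := by
  have h1 := model_one_lt_right P
  rw [← sign_eq_neg_one_iff, modelOne_sign_H P P.right_mem, sign_eq_neg_one_iff, neg_lt_zero]
  have : 0 < (P.c P.b).1 - 1 := sub_pos.2 h1
  have : 0 < (P.c P.b).1 + 3 / 2 := by linarith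
  positivity

theorem modelTwo_sign_H {κ : ℝ} (hκ : -1 < κ) (P : Arc (modelTwo r κ)) {s : ℝ}
    (hs : s ∈ Icc P.a P.b) : SignType.sign (P.H s) = SignType.sign ((P.c s).1 - κ) := by
  have h := model_sign_H (by linarith : 0 < 1 + κ) hs
  have h2 : (1 + κ) * ((P.c s).1 - 1) + ((P.c s).1 + 1) * (1 - κ) = 2 * ((P.c s).1 - κ) := by ring
  rw [h2, sign_mul, sign_pos two_pos, one_mul] at h
  exact h

theorem modelTwo_isSliding {κ : ℝ} (hκ : -1 < κ) (P : Arc (modelTwo r κ)) : P.IsSliding :=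
  model_isSliding (by linarith)

theorem modelTwo_one_existsUnique_zero (P : Arc (modelTwo r 1)) :
    ∃! s : ℝ, s ∈ Ioo P.a P.b ∧ P.H s = 0 := by
  refine model_existsUnique_zero fun s hs _ => ?_
  have h : P.H s = 0 ↔ (P.c s).1 = 1 := by
    rw [← sign_eq_zero_iff, modelTwo_sign_H (by norm_num) P hs, sign_eq_zero_iff, sub_eq_zero]
  exact h

theorem modelTwo_one_H_right (P : Arc (modelTwo r 1)) : 0 < P.H P.b := by
  rw [← sign_eq_one_iff, modelTwo_sign_H (by norm_num) P P.right_mem, sign_eq_one_iff, sub_pos]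
  exact model_one_lt_right P

theorem modelTwo_neg_one_lt {κ : ℝ} (P : Arc (modelTwo r κ)) (h : P.c P.b = (κ, 0)) : -1 < κ := by
  have := model_right_gt_neg_one P
  rwa [h] at this

theorem modelTwo_H_right {κ : ℝ} (P : Arc (modelTwo r κ)) (h : P.c P.b = (κ, 0)) :
    P.H P.b = 0 := by
  rw [← sign_eq_zero_iff, modelTwo_sign_H (modelTwo_neg_one_lt P h) P P.right_mem, h, sub_self,
    sign_zero]

theorem modelTwo_H_ne_zero {κ : ℝ} (P : Arc (modelTwo r κ)) (h : P.c P.b = (κ, 0)) :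
    ∀ s ∈ Ioo P.a P.b, P.H s ≠ 0 := by
  intro s hs
  have hlt := model_strictMonoOn P (Ioo_subset_Icc_self hs) P.right_mem hs.2
  simp only [h] at hlt
  rw [← sign_ne_zero, modelTwo_sign_H (modelTwo_neg_one_lt P h) P (Ioo_subset_Icc_self hs),
    sign_ne_zero]
  exact (sub_neg.2 hlt).ne

end Arc

/-- The model field `X₁` is a linear focus, so that the solution from `A = (-1, 0)` is explicit. Its
second component rises from `0` on `[0, π]`, falls on `[π, 2π]`, and is negative at `2π`. -/
theorem exists_modelArc : ∃ β : ℝ, ∀ (r : ℕ∞) (g : ℝ → ℝ) (hg : ContDiff ℝ r g) (k : ℝ), k ≠ 0 →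
    ∃ P : Arc (modelField r g hg k), P.c P.b = (β, 0) := by
  set x : ℝ → ℝ := fun t => Real.exp t * (-Real.cos t - Real.sin t) with hx
  set z : ℝ → ℝ := fun t => 1 + Real.exp t * (Real.sin t - Real.cos t) with hz
  have hzd : ∀ t, HasDerivAt z (-x t + z t - 1) t := fun t => by
    refine (((Real.hasDerivAt_exp t).mul
      ((Real.hasDerivAt_sin t).sub (Real.hasDerivAt_cos t))).const_add 1).congr_deriv ?_
    simp only [hx, hz, Pi.sub_apply]
    ring
  have hxd : ∀ t, HasDerivAt x (x t + z t - 1) t := fun t => by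
    refine ((Real.hasDerivAt_exp t).mul
      ((Real.hasDerivAt_cos t).neg.sub (Real.hasDerivAt_sin t))).congr_deriv ?_
    simp only [hx, hz, Pi.sub_apply, Pi.neg_apply]
    ring
  have hsin : ∀ t, -x t + z t - 1 = 2 * Real.exp t * Real.sin t := fun t => by
    simp only [hx, hz]
    ring
  have hzc : Continuous z := continuous_iff_continuousAt.2 fun t => (hzd t).continuousAt
  have hz0 : z 0 = 0 := by simp [hz]
  have hx0 : x 0 = -1 := by simp [hx]
  have hup : StrictMonoOn z (Icc 0 Real.pi) := by
    refine strictMonoOn_of_deriv_pos (convex_Icc _ _) hzc.continuousOn fun t ht => ?_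
    rw [interior_Icc] at ht
    rw [(hzd t).deriv, hsin]
    have := Real.sin_pos_of_mem_Ioo ht
    positivity
  have hsin_neg : ∀ t ∈ Ioo Real.pi (2 * Real.pi), Real.sin t < 0 := fun t ht => by
    have := Real.sin_pos_of_mem_Ioo (x := t - Real.pi) ⟨by linarith [ht.1], by linarith [ht.2]⟩
    rw [Real.sin_sub_pi] at this
    linarith
  have hdown : StrictAntiOn z (Icc Real.pi (2 * Real.pi)) := by
    refine strictAntiOn_of_deriv_neg (convex_Icc _ _) hzc.continuousOn fun t ht => ?_
    rw [interior_Icc] at ht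
    rw [(hzd t).deriv, hsin]
    have := hsin_neg t ht
    have := Real.exp_pos t
    nlinarith
  have hpi := Real.pi_pos
  have hzpi : 0 < z Real.pi := by
    rw [← hz0]
    exact hup (left_mem_Icc.2 hpi.le) (right_mem_Icc.2 hpi.le) hpi
  have hz2pi : z (2 * Real.pi) < 0 := by
    simp only [hz, Real.sin_two_pi, Real.cos_two_pi]
    have : 1 < Real.exp (2 * Real.pi) := Real.one_lt_exp_iff.2 (by positivity)
    linarith
  obtain ⟨T, hT, hzT⟩ := intermediate_value_Ioo' (by linarith : Real.pi ≤ 2 * Real.pi)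
    hzc.continuousOn ⟨hz2pi, hzpi⟩
  have hT0 : 0 < T := hpi.trans hT.1
  have hpos : ∀ t ∈ Ioo 0 T, 0 < z t := by
    intro t ht
    rcases le_total t Real.pi with h | h
    · rw [← hz0]
      exact hup (left_mem_Icc.2 hpi.le) ⟨ht.1.le, h⟩ ht.1
    · rw [← hzT]
      exact hdown ⟨h, (ht.2.trans hT.2).le⟩ (Ioo_subset_Icc_self hT) ht.2
  have hβ : -x T - 1 < 0 := by
    have h1 := hsin T
    rw [hzT, add_zero] at h1
    rw [h1]
    have := hsin_neg T hT
    have := Real.exp_pos T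
    nlinarith
  refine ⟨x T, fun r g hg k hk => ?_⟩
  have hcd : ∀ s : ℝ, HasDerivAt (fun s : ℝ => (s, (0 : ℝ))) (1, 0) s := fun s =>
    (hasDerivAt_id s).prodMk (hasDerivAt_const s 0)
  have hcontact : (modelField r g hg k).IsContact (-1, 0) := by
    refine ⟨⟨mem_univ _, rfl⟩, ?_, ?_, fun h => ?_⟩
    · rw [lie_modelField₁]
      norm_num
    · rw [lie_modelField₁, lie_modelField₂]
      simpa using hk.symm
    · have := congrArg Prod.fst h
      rw [slidingField_modelField_fst] at this
      norm_num [hk] at this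
  exact ⟨{
    a := -1
    b := x T
    c := fun s => (s, 0)
    T := T
    γ := fun t => (x t, z t)
    a_lt_b := by linarith
    smooth_c := fun s _ => by fun_prop
    regular_c := fun s _ => by
      rw [(hcd s).deriv]
      simp
    injOn_c := fun s _ t _ h => congrArg Prod.fst h
    c_mem := fun s _ => ⟨mem_univ _, rfl⟩
    visibleFold := by
      refine ⟨hcontact, ?_, ?_⟩
      · rw [lie_modelField₁]
        norm_num
      · rw [lie_lie_modelField₁]
        norm_num
    only_fold := by
      rintro ⟨u, v⟩ ⟨⟨⟨-, hv⟩, -⟩, ⟨h, -⟩ | ⟨h, -⟩⟩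
      · change v = 0 at hv
        rw [lie_modelField₁, hv] at h
        rw [hv]
        exact Prod.ext (by dsimp only at h ⊢; linarith) rfl
      · rw [lie_modelField₂] at h
        exact absurd h hk
    T_pos := hT0
    solution_γ := fun t _ => ((hxd t).prodMk (hzd t)).hasDerivWithinAt
    γ_start := by rw [hx0, hz0]
    γ_end := by rw [hzT]
    γ_mem := fun t ht => ⟨mem_univ _, hpos t ht⟩
    transversal := by
      rw [lie_modelField₁]
      dsimp only
      linarith }, rfl⟩

end NonSmooth

end

theorem proposition1 (r : ℕ∞) (hr : 1 ≤ r) (Z : NonSmooth.Field r) (P : NonSmooth.Arc Z) :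
    (P.IsFirstConfiguration ↔
      P.HWellDefined ∧ (∃! s : ℝ, s ∈ Set.Ioo P.a P.b ∧ P.H s = 0) ∧ P.H P.b < 0) ∧
    (P.IsSecondConfiguration ↔
      P.HWellDefined ∧ (∃! s : ℝ, s ∈ Set.Ioo P.a P.b ∧ P.H s = 0) ∧ 0 < P.H P.b) ∧
    (P.IsThirdConfiguration ↔
      P.HWellDefined ∧ (∀ s ∈ Set.Ioo P.a P.b, P.H s ≠ 0) ∧ P.H P.b = 0) := by
  open NonSmooth Arc in
  simp only [hWellDefined_iff]
  obtain ⟨β, hβ⟩ := exists_modelArc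
  refine ⟨⟨?_, ?_⟩, ⟨?_, ?_⟩, ⟨?_, ?_⟩⟩
  · rintro ⟨P', h⟩
    obtain ⟨hP, hs⟩ := h.isSliding_and_sameSigns hr (modelOne_isSliding P')
    refine ⟨hP, hs.existsUnique_zero (modelOne_existsUnique_zero P'), ?_⟩
    rw [← sign_eq_neg_one_iff, hs.sign_right, sign_eq_neg_one_iff]
    exact modelOne_H_right P'
  · rintro ⟨hP, h0, hb⟩
    obtain ⟨P', -⟩ := hβ r (fun x => -x ^ 2 + 3 / 2 * x - 1 / 2) (by fun_prop) 1 one_ne_zero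
    refine ⟨P', (sameSigns_of_existsUnique_zero hr hP (modelOne_isSliding P') h0
      (modelOne_existsUnique_zero P') hb.ne ?_).topEquiv hr hP (modelOne_isSliding P')⟩
    rw [sign_neg hb, sign_neg (modelOne_H_right P')]
  · rintro ⟨P', h⟩
    obtain ⟨hP, hs⟩ := h.isSliding_and_sameSigns hr (modelTwo_isSliding (by norm_num) P')
    refine ⟨hP, hs.existsUnique_zero (modelTwo_one_existsUnique_zero P'), ?_⟩
    rw [← sign_eq_one_iff, hs.sign_right, sign_eq_one_iff]
    exact modelTwo_one_H_right P'
  · rintro ⟨hP, h0, hb⟩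
    obtain ⟨P', -⟩ := hβ r (fun _ => 1 - 1) contDiff_const (1 + 1) (by norm_num)
    have hP' := modelTwo_isSliding (by norm_num) P'
    refine ⟨P', (sameSigns_of_existsUnique_zero hr hP hP' h0
      (modelTwo_one_existsUnique_zero P') hb.ne' ?_).topEquiv hr hP hP'⟩
    rw [sign_pos hb, sign_pos (modelTwo_one_H_right P')]
  · rintro ⟨κ, P', hκ, h⟩
    obtain ⟨hP, hs⟩ := h.isSliding_and_sameSigns hr
      (modelTwo_isSliding (modelTwo_neg_one_lt P' hκ) P')
    refine ⟨hP, hs.ne_zero (modelTwo_H_ne_zero P' hκ), ?_⟩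
    rw [← sign_eq_zero_iff, hs.sign_right, sign_eq_zero_iff]
    exact modelTwo_H_right P' hκ
  · rintro ⟨hP, h0, hb⟩
    have hβ1 : 1 + β ≠ 0 := by
      obtain ⟨P', hP'⟩ := hβ r (fun _ => 0) contDiff_const 1 one_ne_zero
      have := model_one_lt_right P'
      rw [hP'] at this
      dsimp only at this
      linarith
    obtain ⟨P', hκ⟩ := hβ r (fun _ => 1 - β) contDiff_const (1 + β) hβ1
    have hP' := modelTwo_isSliding (modelTwo_neg_one_lt P' hκ) P'
    exact ⟨β, P', hκ, (sameSigns_of_ne_zero hr hP hP' h0 (modelTwo_H_ne_zero P' hκ) hb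
      (modelTwo_H_right P' hκ)).topEquiv hr hP hP'⟩
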